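/- Let $\hbar$ be an indeterminate, $q=e^{\hbar}\in\mathbb C[[\hbar]]$, $q^{a}=e^{\hbar a}$, $\kappa_q=q-q^{-1}$, $[2]_q=q+q^{-1}$. Let $\mathrm U_q(\mathfrak{gl}_{2|1})$ be the $\hbar$-adically complete unital associative $\mathbb C[[\hbar]]$-superalgebra topologically generated by even elements $K_1,K_2,K_3,E_1,F_1$ and odd elements $E_2,F_2$ with the relations (where $[1]=0$, $[2]=1$, $H_1=K_1-K_2$, $H_2=K_2+K_3$, and $\alpha_1(K_1)=1$, $\alpha_1(K_2)=-1$, $\alpha_1(K_3)=0$, $\alpha_2(K_1)=0$, $\alpha_2(K_2)=1$, $\alpha_2(K_3)=-1$) $$K_iK_j=K_jK_i,\quad K_iE_j-E_jK_i=\alpha_j(K_i)E_j,\quad K_iF_j-F_jK_i=-\alpha_j(K_i)F_j,$$ $$E_iF_j-(-1)^{[i][j]}F_jE_i=\delta_{ij}\frac{q^{H_i}-q^{-H_i}}{q-q^{-1}},\quad E_2^2=F_2^2=0,$$ $$E_1^2E_2-[2]_qE_1E_2E_1+E_2E_1^2=0,\quad F_1^2F_2-[2]_qF_1F_2F_1+F_2F_1^2=0.$$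 Put $E_{12}=\bar E_{12}=E_1$, $E_{23}=\bar E_{23}=E_2$, $F_{12}=F_1$, $F_{23}=F_2$, $\bar E_{13}=E_1E_2-q^{-1}E_2E_1$, $F_{13}=F_2F_1-q^{-1}F_1F_2$, and $$\Phi_1=q^{2K_1}+q^{-2}q^{2K_2}-q^{-2}q^{-2K_3}+\kappa_q^2\bigl(q^{-1}F_{12}\bar E_{12}q^{K_1+K_2}+qF_{13}\bar E_{13}q^{K_1-K_3}+q^{-1}F_{23}\bar E_{23}q^{K_2-K_3}\bigr),$$ $$\begin{aligned}\Phi_2={}&q^{4K_1}+q^{-4}q^{4K_2}-q^{-4}q^{-4K_3}+\kappa_q^2[2]_q\bigl(q^{-4}F_{12}\bar E_{12}q^{K_1+3K_2}+F_{12}\bar E_{12}q^{3K_1+K_2}+F_{13}\bar E_{13}q^{K_1-3K_3}\\&+q^2F_{13}\bar E_{13}q^{3K_1-K_3}+q^{-2}F_{23}\bar E_{23}q^{K_2-3K_3}+q^{-2}F_{23}\bar E_{23}q^{3K_2-K_3}\bigr)\\&+\kappa_q^3[2]_q\bigl(q^{-2}F_{12}F_{23}\bar E_{13}q^{K_1+2K_2-K_3}+q^{-1}F_{13}\bar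 E_{12}\bar E_{23}q^{K_1+2K_2-K_3}\bigr)\\&+\kappa_q^4[2]_q\bigl(qF_{12}F_{13}\bar E_{12}\bar E_{13}q^{2K_1+K_2-K_3}+qF_{13}F_{23}\bar E_{13}\bar E_{23}q^{K_1+K_2-2K_3}\bigr)+\kappa_q^4q^{-2}F_{12}^2\bar E_{12}^2q^{2K_1+2K_2}.\end{aligned}$$ Then $\Phi_1$ and $\Phi_2$ are even and belong to the center of $\mathrm U_q(\mathfrak{gl}_{2|1})$. For every $\lambda=(\lambda_1,\lambda_2,\lambda_3)\in\mathbb C^3$ they act on the irreducible highest weight module $V^\lambda$ by the scalars $$\chi_\lambda(\Phi_1)=q^{2\lambda_1}+q^{2\lambda_2-2}-q^{-2\lambda_3-2},\qquad \chi_\lambda(\Phi_2)=q^{4\lambda_1}+q^{4\lambda_2-4}-q^{-4\lambda_3-4},$$ and they act by the same scalars on every highest weight module of highest weight $\lambda$, that is, on every module $V$ generated by a vector $v\neq0$ with $E_iv=0$ and $K_iv=\lambda_iv$. Here $V^\lambda$ is the quotient of the Verma module of highest weight $\lambda$, with highest weight vector $v^\lambda$, by its largest submodule meeting $\mathbb C[[\hbar]]v^\lambda$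 in $0$. -/

import Mathlib

open scoped PowerSeries

noncomputable section

namespace QuantumGl21

/-! ### Formal exponentials `q ^ a = exp (ħ a)`, where the indeterminate `ħ` is `PowerSeries.X` -/

section Exponentials

/-- `q ^ a = exp (ħ a) = ∑ₙ aⁿ / n! ħⁿ`, for an element `a` of a `ℂ`-algebra `A`; it is a formal
power series in `ħ` with coefficients in `A`. For `A = ℂ` this is the usual complex power of
`q = exp ħ`. -/
def qExp {A : Type*} [Ring A] [Algebra ℂ A] (a : A) : A⟦X⟧ :=
  PowerSeries.mk fun n => ((n.factorial : ℂ)⁻¹) • a ^ n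

/-- The complex powers `q ^ c` of `q = exp ħ`, as elements of `ℂ[[ħ]]`. -/
abbrev qc (c : ℂ) : ℂ⟦X⟧ := qExp c

/-- `κ_q = q - q⁻¹`. -/
def kappa : ℂ⟦X⟧ := qc 1 - qc (-1)

/-- `[2]_q = q + q⁻¹`. -/
def qTwo : ℂ⟦X⟧ := qc 1 + qc (-1)

/-- The quotient `(f - f(0)) / ħ` of a power series `f` in `ħ`. -/
def divHbar {A : Type*} [Ring A] (f : A⟦X⟧) : A⟦X⟧ :=
  PowerSeries.mk fun n => PowerSeries.coeff (n + 1) f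

end Exponentials

/-! ### The complete free algebra on the generators -/

/-- The generators of `U_q(gl_{2|1})`. The indices are shifted by one: `K 0, K 1, K 2` are the
usual `K₁, K₂, K₃`, and similarly for `E` and `F`. -/
inductive Gen : Type
  | K (i : Fin 3) : Gen
  | E (i : Fin 2) : Gen
  | F (i : Fin 2) : Gen

/-- The free complex algebra on the generators. -/
abbrev FreeGen : Type := FreeAlgebra ℂ Gen

/-- The free algebra over `ℂ[[ħ]]` on the generators, completed `ħ`-adically: formal power series
in `ħ` with coefficients in the free complex algebra on the generators. -/
def CFree : Type := FreeGen⟦X⟧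

namespace CFree

instance : Ring CFree := inferInstanceAs (Ring (PowerSeries FreeGen))

/-- The identity map, which regards a power series as an element of the complete free algebra. -/
def ofSeries : FreeGen⟦X⟧ ≃+* CFree := RingEquiv.refl (PowerSeries FreeGen)

/-- The inclusion of the scalars `ℂ[[ħ]]`. -/
def scalars : ℂ⟦X⟧ →+* CFree :=
  ofSeries.toRingHom.comp (PowerSeries.map (algebraMap ℂ FreeGen))

theorem scalars_commutes (c : ℂ⟦X⟧) (x : CFree) : scalars c * x = x * scalars c := by
  obtain ⟨f, rfl⟩ := ofSeries.surjective x
  change ofSeries (PowerSeries.map (algebraMap ℂ FreeGen) c) * ofSeries f =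
    ofSeries f * ofSeries (PowerSeries.map (algebraMap ℂ FreeGen) c)
  rw [← map_mul, ← map_mul]
  congr 1
  refine PowerSeries.ext fun n => ?_
  rw [PowerSeries.coeff_mul, PowerSeries.coeff_mul, ← Finset.Nat.sum_antidiagonal_swap]
  refine Finset.sum_congr rfl fun p _ => ?_
  simp only [Prod.fst_swap, Prod.snd_swap, PowerSeries.coeff_map]
  exact Algebra.commutes _ _

instance : Algebra ℂ⟦X⟧ CFree := RingHom.toAlgebra' scalars scalars_commutes

/-- The coefficient of `ħⁿ`. -/
def coeff (n : ℕ) (x : CFree) : FreeGen := PowerSeries.coeff n (ofSeries.symm x)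

/-- The generators, as series that are constant in `ħ`. -/
def gen (g : Gen) : CFree := ofSeries (PowerSeries.C (FreeAlgebra.ι ℂ g))

/-- `q ^ a = exp (ħ a)` for `a` in the free algebra. -/
def qpow (a : FreeGen) : CFree := ofSeries (qExp a)

/-- `[a]_q = (q ^ a - q ^ (-a)) / (q - q⁻¹)`. Numerator and denominator are both divisible by `ħ`,
and `(q - q⁻¹) / ħ` is a unit of `ℂ[[ħ]]`. -/
def qnum (a : FreeGen) : CFree :=
  (divHbar kappa)⁻¹ • ofSeries (divHbar (qExp a - qExp (-a)))

theorem hbar_smul_divHbar (f : FreeGen⟦X⟧) (hf : PowerSeries.coeff 0 f = 0) :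
    (PowerSeries.X : ℂ⟦X⟧) • ofSeries (divHbar f) = ofSeries f := by
  change ofSeries (PowerSeries.map (algebraMap ℂ FreeGen) PowerSeries.X) *
    ofSeries (divHbar f) = ofSeries f
  rw [PowerSeries.map_X, ← map_mul]
  congr 1
  refine PowerSeries.ext fun n => ?_
  cases n with
  | zero => rw [PowerSeries.coeff_zero_X_mul, hf]
  | succ n => rw [PowerSeries.coeff_succ_X_mul, divHbar, PowerSeries.coeff_mk]

theorem kappa_eq : kappa = PowerSeries.X * divHbar kappa := by
  refine PowerSeries.ext fun n => ?_
  cases n with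
  | zero => simp [kappa, qExp]
  | succ n => rw [PowerSeries.coeff_succ_X_mul, divHbar, PowerSeries.coeff_mk]

/-- `[a]_q` is the solution `x` of `(q - q⁻¹) x = q ^ a - q ^ (-a)`. -/
theorem kappa_smul_qnum (a : FreeGen) : kappa • qnum a = qpow a - qpow (-a) := by
  have hc : PowerSeries.constantCoeff (divHbar kappa) ≠ 0 := by
    rw [← PowerSeries.coeff_zero_eq_constantCoeff_apply, divHbar, PowerSeries.coeff_mk]
    simp [kappa, qExp]
  have hk : kappa * (divHbar kappa)⁻¹ = PowerSeries.X := by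
    nth_rewrite 1 [kappa_eq]
    rw [mul_assoc, PowerSeries.mul_inv_cancel _ hc, mul_one]
  rw [qnum, smul_smul, hk, hbar_smul_divHbar _ (by simp [qExp]), map_sub, qpow, qpow]

end CFree

/-! ### The root lattice and the `q`-supercommutator -/

/-- The root lattice; the pair `(m, n)` stands for `m α₁ + n α₂`. -/
abbrev RootLattice : Type := ℤ × ℤ

/-- The simple roots. -/
def simpleRoot (j : Fin 2) : RootLattice := ![(1, 0), (0, 1)] j

/-- The bilinear form with `(α₁|α₁) = 2`, `(α₁|α₂) = (α₂|α₁) = -1`, `(α₂|α₂) = 0`. -/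
def bil (a b : RootLattice) : ℤ := 2 * a.1 * b.1 - a.1 * b.2 - a.2 * b.1

/-- The parity: `α₁` is even and `α₂` is odd. -/
def par (a : RootLattice) : ZMod 2 := a.2

/-- The exponent of `q` in the `q`-supercommutator of elements of weights `a` and `b`. -/
def bracketExp (a b : RootLattice) : ℤ :=
  if (0 ≤ a.1 ∧ 0 ≤ a.2) ∧ (0 ≤ b.1 ∧ 0 ≤ b.2) then -bil a b
  else if (a.1 ≤ 0 ∧ a.2 ≤ 0) ∧ (b.1 ≤ 0 ∧ b.2 ≤ 0) then bil a b
  else 0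

/-- The `q`-supercommutator `⟦x, y⟧ = x y - (-1)^([a][b]) q^e y x` of elements `x`, `y` of weights
`a`, `b`, where `e = -(a|b)` if `a, b ∈ Q₊`, `e = (a|b)` if `a, b ∈ Q₋`, and `e = 0` otherwise. -/
def qbracket (a b : RootLattice) (x y : CFree) : CFree :=
  x * y - ((-1 : ℂ⟦X⟧) ^ (par a * par b).val * qc (bracketExp a b : ℂ)) • (y * x)

/-- The value `α_j(K_i)` of a simple root on the `i`-th diagonal matrix unit:
`α₁ = Ξ₁ - Ξ₂`, `α₂ = Ξ₂ - Ξ₃`. -/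
def rootVal (j : Fin 2) (i : Fin 3) : ℂ := ![![1, -1, 0], ![0, 1, -1]] j i

/-- `H₁ = K₁ - K₂` and `H₂ = K₂ + K₃`. -/
def cartanH (i : Fin 2) : FreeGen :=
  ![FreeAlgebra.ι ℂ (Gen.K 0) - FreeAlgebra.ι ℂ (Gen.K 1),
    FreeAlgebra.ι ℂ (Gen.K 1) + FreeAlgebra.ι ℂ (Gen.K 2)] i

/-! ### The quantum superalgebra `U_q(gl_{2|1})` -/

open CFree in
/-- The elements of the complete free algebra that the defining relations set to zero. -/
inductive Relator : CFree → Prop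
  | KK (i j : Fin 3) : Relator (qbracket 0 0 (gen (.K i)) (gen (.K j)))
  | KE (i : Fin 3) (j : Fin 2) :
      Relator (qbracket 0 (simpleRoot j) (gen (.K i)) (gen (.E j)) -
        PowerSeries.C (rootVal j i) • gen (.E j))
  | KF (i : Fin 3) (j : Fin 2) :
      Relator (qbracket 0 (-simpleRoot j) (gen (.K i)) (gen (.F j)) +
        PowerSeries.C (rootVal j i) • gen (.F j))
  | EF (i j : Fin 2) :
      Relator (qbracket (simpleRoot i) (-simpleRoot j) (gen (.E i)) (gen (.F j)) -
        if i = j then qnum (cartanH i) else 0)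
  | EE : Relator (qbracket (simpleRoot 1) (simpleRoot 1) (gen (.E 1)) (gen (.E 1)))
  | FF : Relator (qbracket (-simpleRoot 1) (-simpleRoot 1) (gen (.F 1)) (gen (.F 1)))
  | serreE : Relator (qbracket (simpleRoot 0) (simpleRoot 0 + simpleRoot 1) (gen (.E 0))
      (qbracket (simpleRoot 0) (simpleRoot 1) (gen (.E 0)) (gen (.E 1))))
  | serreF : Relator (qbracket (-simpleRoot 0) (-simpleRoot 0 + -simpleRoot 1) (gen (.F 0))
      (qbracket (-simpleRoot 0) (-simpleRoot 1) (gen (.F 0)) (gen (.F 1))))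

/-- The `ħ`-adic closure `⋂ₙ (I + ħⁿ)` of the two-sided ideal `I` generated by the relators. -/
def relIdeal : TwoSidedIdeal CFree :=
  ⨅ n : ℕ, (TwoSidedIdeal.span {x | Relator x} ⊔
    TwoSidedIdeal.span {algebraMap ℂ⟦X⟧ CFree (PowerSeries.X ^ n)})

/-- The quantum superalgebra `U_q(gl_{2|1})` over `ℂ[[ħ]]`, `q = exp ħ`: the `ħ`-adically complete
algebra topologically generated by `K₁, K₂, K₃, E₁, E₂, F₁, F₂` with the defining relations. -/
def U : Type := relIdeal.ringCon.Quotient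

instance : Ring U := inferInstanceAs (Ring relIdeal.ringCon.Quotient)

instance : Algebra ℂ⟦X⟧ U := inferInstanceAs (Algebra ℂ⟦X⟧ relIdeal.ringCon.Quotient)

/-- The quotient map from the complete free algebra. -/
def toU : CFree →ₐ[ℂ⟦X⟧] U := RingCon.mkₐ ℂ⟦X⟧ relIdeal.ringCon

namespace U

/-- The generators `K₁, K₂, K₃` (as `K 0, K 1, K 2`). -/
def K (i : Fin 3) : U := toU (CFree.gen (.K i))

/-- The generators `E₁, E₂` (as `E 0, E 1`). -/
def E (i : Fin 2) : U := toU (CFree.gen (.E i))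

/-- The generators `F₁, F₂` (as `F 0, F 1`). -/
def F (i : Fin 2) : U := toU (CFree.gen (.F i))

/-- `qK a b c` is `q ^ (a K₁ + b K₂ + c K₃)`. -/
def qK (a b c : ℤ) : U :=
  toU (CFree.qpow (a • FreeAlgebra.ι ℂ (Gen.K 0) + b • FreeAlgebra.ι ℂ (Gen.K 1) +
    c • FreeAlgebra.ι ℂ (Gen.K 2)))

end U

/-- The parity automorphism of the free complex algebra: `E₂` and `F₂` change sign, the other
generators are fixed. -/
def parityAut : FreeGen →ₐ[ℂ] FreeGen :=
  FreeAlgebra.lift ℂ fun g => match g with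
    | .K i => FreeAlgebra.ι ℂ (.K i)
    | .E i => (-1 : ℂ) ^ (par (simpleRoot i)).val • FreeAlgebra.ι ℂ (.E i)
    | .F i => (-1 : ℂ) ^ (par (simpleRoot i)).val • FreeAlgebra.ι ℂ (.F i)

/-- `u ∈ U` is homogeneous of parity `p`: it is represented by a series in `ħ` all of whose
coefficients are homogeneous of parity `p`. -/
def HasParity (p : ZMod 2) (u : U) : Prop :=
  ∃ x : CFree, (∀ n, parityAut (x.coeff n) = (-1 : ℂ) ^ p.val • x.coeff n) ∧ toU x = u

/-! ### The central elements -/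

namespace U

/-- `E₁₂ = E₁`, which is also `Ē₁₂`. -/
def E12 : U := E 0

/-- `E₂₃ = E₂`, which is also `Ē₂₃`. -/
def E23 : U := E 1

/-- `F₁₂ = F₁`. -/
def F12 : U := F 0

/-- `F₂₃ = F₂`. -/
def F23 : U := F 1

/-- `Ē₁₃ = E₁ E₂ - q⁻¹ E₂ E₁`. -/
def Ebar13 : U := E 0 * E 1 - qc (-1) • (E 1 * E 0)

/-- `F₁₃ = F₂ F₁ - q⁻¹ F₁ F₂`. -/
def F13 : U := F 1 * F 0 - qc (-1) • (F 0 * F 1)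

/-- The element `Φ₁`. -/
def Phi1 : U :=
  qK 2 0 0 + qc (-2) • qK 0 2 0 - qc (-2) • qK 0 0 (-2)
    + kappa ^ 2 • (qc (-1) • (F12 * E12 * qK 1 1 0)
      + qc 1 • (F13 * Ebar13 * qK 1 0 (-1))
      + qc (-1) • (F23 * E23 * qK 0 1 (-1)))

/-- The element `Φ₂`. -/
def Phi2 : U :=
  qK 4 0 0 + qc (-4) • qK 0 4 0 - qc (-4) • qK 0 0 (-4)
    + (kappa ^ 2 * qTwo) • (qc (-4) • (F12 * E12 * qK 1 3 0)
      + F12 * E12 * qK 3 1 0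
      + F13 * Ebar13 * qK 1 0 (-3)
      + qc 2 • (F13 * Ebar13 * qK 3 0 (-1))
      + qc (-2) • (F23 * E23 * qK 0 1 (-3))
      + qc (-2) • (F23 * E23 * qK 0 3 (-1)))
    + (kappa ^ 3 * qTwo) • (qc (-2) • (F12 * F23 * Ebar13 * qK 1 2 (-1))
      + qc (-1) • (F13 * E12 * E23 * qK 1 2 (-1)))
    + (kappa ^ 4 * qTwo) • (qc 1 • (F12 * F13 * E12 * Ebar13 * qK 2 1 (-1))
      + qc 1 • (F13 * F23 * Ebar13 * E23 * qK 1 1 (-2)))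
    + (kappa ^ 4 * qc (-2)) • (F12 ^ 2 * E12 ^ 2 * qK 2 2 0)

end U

/-! ### Highest weight modules -/

/-- `V` is a highest weight `U`-module of highest weight `l = (λ₁, λ₂, λ₃) ∈ ℂ³`, with highest
weight vector `v`. -/
structure IsHighestWeight (V : Type*) [AddCommGroup V] [Module ℂ⟦X⟧ V] [Module U V]
    (l : Fin 3 → ℂ) (v : V) : Prop where
  ne_zero : v ≠ 0
  E_smul : ∀ i, U.E i • v = 0
  K_smul : ∀ i, U.K i • v = (PowerSeries.C (l i) : ℂ⟦X⟧) • v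
  span_eq_top : Submodule.span U {v} = ⊤

/-- The left ideal generated by `E₁, E₂` and `K_i - λ_i`, `i = 1, 2, 3`. -/
def vermaIdeal (l : Fin 3 → ℂ) : Submodule U U :=
  Submodule.span U (Set.range U.E ∪
    Set.range fun i => U.K i - algebraMap ℂ⟦X⟧ U (PowerSeries.C (l i)))

/-- The Verma module of highest weight `l`. -/
abbrev Verma (l : Fin 3 → ℂ) : Type := U ⧸ vermaIdeal l

/-- The highest weight vector of the Verma module. -/
def vermaVec (l : Fin 3 → ℂ) : Verma l := Submodule.Quotient.mk 1

/-- The maximal submodule of the Verma module. Since `ħ` times a module over `ℂ[[ħ]]` is always a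
proper submodule, "maximal" refers to the submodules that meet the highest weight space
`ℂ[[ħ]] v` trivially (equivalently, that stay proper after `ħ` is inverted); this is the largest
of them. -/
def maxSubmodule (l : Fin 3 → ℂ) : Submodule U (Verma l) :=
  sSup {N | ∀ c : ℂ⟦X⟧, c • vermaVec l ∈ N → c • vermaVec l = 0}

/-- The irreducible highest weight module `V^λ`, of highest weight `l`: the quotient of the Verma
module by its maximal submodule. It has finite rank over `ℂ[[ħ]]` if `λ₁ - λ₂` is a non-negative
integer. -/
abbrev IrrModule (l : Fin 3 → ℂ) : Type := Verma l ⧸ maxSubmodule l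

/-- `q^{2λ₁} + q^{2λ₂-2} - q^{-2λ₃-2}`. -/
def chi1 (l : Fin 3 → ℂ) : ℂ⟦X⟧ := qc (2 * l 0) + qc (2 * l 1 - 2) - qc (-2 * l 2 - 2)

/-- `q^{4λ₁} + q^{4λ₂-4} - q^{-4λ₃-4}`. -/
def chi2 (l : Fin 3 → ℂ) : ℂ⟦X⟧ := qc (4 * l 0) + qc (4 * l 1 - 4) - qc (-4 * l 2 - 4)

end QuantumGl21

end

/-! Centrality is a finite computation made topological. The first half uses only the relations over
an arbitrary commutative ring, with `t n` standing for `qⁿ`. Since `q - q⁻¹` need not be invertible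
there, one copy of it is absorbed into each negative root vector; the commutators of `E₁`, `E₂` with
these rescaled vectors then have no denominators (`Relations.normalOrder`). Moving `E₁` or `E₂`
through each element and collecting ordered monomials gives equal coefficients
(`NormalOrder.commute_scaledPhi`).

The lowering operators need no second computation of this kind: the relations are stable under the
anti-automorphism that exchanges `E_i` and `F_i` and fixes the Cartan part, and both elements are
fixed by it (`phi1_op`, `phi2_op`). Commutation with `K_i` says that the weight is zero, and
evenness says that the parity is zero; both follow from `phi_mem_of_graded`.

In `U`, which is `ħ`-adically separated, identities between series can be tested on coefficients
(`toU_ofSeries_congr`), which gives the rules for `q^a`; and commuting with the generators suffices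
for centrality (`mem_center_of_commute_gen`). On a highest weight vector only the Cartan terms
survive, and centrality carries the resulting scalar to the whole cyclic module. -/

noncomputable section

namespace QuantumGl21

/-! ### The relations over a general commutative ring -/

section Abstract

variable {R A : Type*} [CommRing R] [Ring A] [Algebra R A]

/-- Normal ordering relations for moving `x₁, x₂` to the right. The elements `y₁, y₂, y₃`
play the role of the negative root vectors multiplied by `q - q⁻¹`, and `t n` that of `qⁿ`. -/
structure NormalOrder (t : ℤ → R) (L : ℤ → ℤ → ℤ → A) (x₁ x₂ x₃ y₁ y₂ y₃ : A) : Prop where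
  t_zero : t 0 = 1
  t_add : ∀ m n, t (m + n) = t m * t n
  L_mul_L : ∀ a b c a' b' c', L a b c * L a' b' c' = L (a + a') (b + b') (c + c')
  L_mul_x₁ : ∀ a b c, L a b c * x₁ = t (a - b) • (x₁ * L a b c)
  L_mul_x₂ : ∀ a b c, L a b c * x₂ = t (b - c) • (x₂ * L a b c)
  L_mul_x₃ : ∀ a b c, L a b c * x₃ = t (a - c) • (x₃ * L a b c)
  x₃_mul_x₁ : x₃ * x₁ = t (-1) • (x₁ * x₃)
  x₂_mul_x₁ : x₂ * x₁ = t 1 • (x₁ * x₂) - t 1 • x₃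
  x₂_mul_x₃ : x₂ * x₃ = -(t 1 • (x₃ * x₂))
  x₂_mul_x₂ : x₂ * x₂ = 0
  x₃_mul_x₃ : x₃ * x₃ = 0
  y₂_mul_y₂ : y₂ * y₂ = 0
  x₁_mul_y₁ : x₁ * y₁ = y₁ * x₁ + L 1 (-1) 0 - L (-1) 1 0
  x₁_mul_y₂ : x₁ * y₂ = y₂ * x₁
  x₂_mul_y₁ : x₂ * y₁ = y₁ * x₂
  x₂_mul_y₂ : x₂ * y₂ = -(y₂ * x₂) + L 0 1 1 - L 0 (-1) (-1)
  x₁_mul_y₃ : x₁ * y₃ = y₃ * x₁ - t (-1) • (y₂ * L (-1) 1 0)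
  x₂_mul_y₃ : x₂ * y₃ = -(y₃ * x₂) + y₁ * L 0 1 1
  L_mul_y₁ : ∀ a b c, L a b c * y₁ = t (b - a) • (y₁ * L a b c)
  L_mul_y₂ : ∀ a b c, L a b c * y₂ = t (c - b) • (y₂ * L a b c)
  L_mul_y₃ : ∀ a b c, L a b c * y₃ = t (c - a) • (y₃ * L a b c)

theorem mul_assoc_of_eq {x y r : A} (h : x * y = r) (z : A) : x * (y * z) = r * z := by
  rw [← mul_assoc, h]

/-- The element `Φ₁` in terms of rescaled negative root vectors. -/
def scaledPhi1 (t : ℤ → R) (L : ℤ → ℤ → ℤ → A) (x₁ x₂ x₃ y₁ y₂ y₃ : A) : A :=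
  L 2 0 0 + t (-2) • L 0 2 0 - t (-2) • L 0 0 (-2)
    + (t 1 - t (-1)) • (t (-1) • (y₁ * x₁ * L 1 1 0) + t 1 • (y₃ * x₃ * L 1 0 (-1))
      + t (-1) • (y₂ * x₂ * L 0 1 (-1)))

/-- The element `Φ₂` in terms of rescaled negative root vectors. -/
def scaledPhi2 (t : ℤ → R) (L : ℤ → ℤ → ℤ → A) (x₁ x₂ x₃ y₁ y₂ y₃ : A) : A :=
  L 4 0 0 + t (-4) • L 0 4 0 - t (-4) • L 0 0 (-4)
    + ((t 1 - t (-1)) * (t 1 + t (-1))) • (t (-4) • (y₁ * x₁ * L 1 3 0)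
      + y₁ * x₁ * L 3 1 0
      + y₃ * x₃ * L 1 0 (-3)
      + t 2 • (y₃ * x₃ * L 3 0 (-1))
      + t (-2) • (y₂ * x₂ * L 0 1 (-3))
      + t (-2) • (y₂ * x₂ * L 0 3 (-1)))
    + ((t 1 - t (-1)) * (t 1 + t (-1))) • (t (-2) • (y₁ * y₂ * x₃ * L 1 2 (-1))
      + ((t 1 - t (-1)) * t (-1)) • (y₃ * x₁ * x₂ * L 1 2 (-1)))
    + ((t 1 - t (-1)) ^ 2 * (t 1 + t (-1))) • (t 1 • (y₁ * y₃ * x₁ * x₃ * L 2 1 (-1))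
      + t 1 • (y₃ * y₂ * x₃ * x₂ * L 1 1 (-2)))
    + ((t 1 - t (-1)) ^ 2 * t (-2)) • (y₁ * y₁ * x₁ * x₁ * L 2 2 0)

/-! ### Commutation with the raising operators by normal ordering -/

namespace NormalOrder

variable {t : ℤ → R} {L : ℤ → ℤ → ℤ → A} {x₁ x₂ x₃ y₁ y₂ y₃ : A}

theorem t_mul_t_neg (h : NormalOrder t L x₁ x₂ x₃ y₁ y₂ y₃) : t 1 * t (-1) = 1 := by
  rw [← h.t_add, ← h.t_zero]; rfl

theorem t_natCast (h : NormalOrder t L x₁ x₂ x₃ y₁ y₂ y₃) (n : ℕ) : t n = t 1 ^ n := by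
  induction n with
  | zero => simpa using h.t_zero
  | succ n ih => rw [Nat.cast_succ, h.t_add, ih, pow_succ]

theorem t_neg_natCast (h : NormalOrder t L x₁ x₂ x₃ y₁ y₂ y₃) (n : ℕ) :
    t (-n) = t (-1) ^ n := by
  induction n with
  | zero => simpa using h.t_zero
  | succ n ih => rw [Nat.cast_succ, neg_add, h.t_add, ih, pow_succ]

set_option linter.unusedSimpArgs false in
set_option maxHeartbeats 1000000 in
theorem commute_scaledPhi (h : NormalOrder t L x₁ x₂ x₃ y₁ y₂ y₃) :
    (Commute x₁ (scaledPhi1 t L x₁ x₂ x₃ y₁ y₂ y₃) ∧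
      Commute x₂ (scaledPhi1 t L x₁ x₂ x₃ y₁ y₂ y₃)) ∧
    (Commute x₁ (scaledPhi2 t L x₁ x₂ x₃ y₁ y₂ y₃) ∧
      Commute x₂ (scaledPhi2 t L x₁ x₂ x₃ y₁ y₂ y₃)) := by
  have hq := h.t_mul_t_neg
  -- All scalars become polynomials in `t 1` and `t (-1)`, whose only relation is `hq`.
  have t2 : t 2 = t 1 ^ 2 := h.t_natCast 2
  have s2 : t (-2) = t (-1) ^ 2 := h.t_neg_natCast 2
  have t3 : t 3 = t 1 ^ 3 := h.t_natCast 3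
  have s3 : t (-3) = t (-1) ^ 3 := h.t_neg_natCast 3
  have t4 : t 4 = t 1 ^ 4 := h.t_natCast 4
  have s4 : t (-4) = t (-1) ^ 4 := h.t_neg_natCast 4
  refine ⟨⟨?_, ?_⟩, ?_, ?_⟩ <;>
  · rw [commute_iff_eq]
    -- Monomials are brought to the form (product of `y`) · (product of `x`, in the order `x₁, x₃,
    -- x₂`) · `L`. Among relations between the `y` only `y₂ * y₂ = 0` is needed: such a square
    -- arises when `x₁` passes `y₃ * y₂`.
    simp only [scaledPhi1, scaledPhi2, mul_add, mul_sub, add_mul, sub_mul, neg_mul, mul_neg,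
      smul_mul_assoc, mul_smul_comm, mul_assoc, mul_zero, zero_mul, smul_zero, smul_neg,
      h.L_mul_L, h.L_mul_x₁, h.L_mul_x₂, h.L_mul_x₃, h.L_mul_y₁, h.L_mul_y₂, h.L_mul_y₃,
      h.y₂_mul_y₂, mul_assoc_of_eq h.y₂_mul_y₂, h.x₂_mul_x₂, h.x₃_mul_x₃,
      mul_assoc_of_eq h.x₁_mul_y₁, mul_assoc_of_eq h.x₁_mul_y₂, mul_assoc_of_eq h.x₁_mul_y₃,
      mul_assoc_of_eq h.x₂_mul_y₁, mul_assoc_of_eq h.x₂_mul_y₂, mul_assoc_of_eq h.x₂_mul_y₃,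
      mul_assoc_of_eq h.x₃_mul_x₁, mul_assoc_of_eq h.x₂_mul_x₁, mul_assoc_of_eq h.x₂_mul_x₃,
      mul_assoc_of_eq h.x₂_mul_x₂, mul_assoc_of_eq h.x₃_mul_x₃,
      fun a b c => mul_assoc_of_eq (h.L_mul_x₁ a b c),
      fun a b c => mul_assoc_of_eq (h.L_mul_x₂ a b c),
      fun a b c => mul_assoc_of_eq (h.L_mul_x₃ a b c),
      fun a b c => mul_assoc_of_eq (h.L_mul_y₁ a b c),
      fun a b c => mul_assoc_of_eq (h.L_mul_y₂ a b c),
      fun a b c => mul_assoc_of_eq (h.L_mul_y₃ a b c),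
      Int.reduceSub, Int.reduceAdd, Int.reduceNeg, t2, s2, t3, s3, t4, s4, h.t_zero]
    match_scalars <;> grind

end NormalOrder

/-! ### Composite root vectors, homogeneity, and the defining relations -/

/-- The vector `Ē₁₃` built from `E₁` and `E₂`. -/
def rootE (t : ℤ → R) (E₁ E₂ : A) : A := E₁ * E₂ - t (-1) • (E₂ * E₁)

/-- The vector `F₁₃` built from `F₁` and `F₂`. -/
def rootF (t : ℤ → R) (F₁ F₂ : A) : A := F₂ * F₁ - t (-1) • (F₁ * F₂)

/-- The element `Φ₁`. -/
def phi1 (t : ℤ → R) (L : ℤ → ℤ → ℤ → A) (E₁ E₂ E₃ F₁ F₂ F₃ : A) : A :=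
  L 2 0 0 + t (-2) • L 0 2 0 - t (-2) • L 0 0 (-2)
    + (t 1 - t (-1)) ^ 2 • (t (-1) • (F₁ * E₁ * L 1 1 0) + t 1 • (F₃ * E₃ * L 1 0 (-1))
      + t (-1) • (F₂ * E₂ * L 0 1 (-1)))

/-- The element `Φ₂`. -/
def phi2 (t : ℤ → R) (L : ℤ → ℤ → ℤ → A) (E₁ E₂ E₃ F₁ F₂ F₃ : A) : A :=
  L 4 0 0 + t (-4) • L 0 4 0 - t (-4) • L 0 0 (-4)
    + ((t 1 - t (-1)) ^ 2 * (t 1 + t (-1))) • (t (-4) • (F₁ * E₁ * L 1 3 0)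
      + F₁ * E₁ * L 3 1 0
      + F₃ * E₃ * L 1 0 (-3)
      + t 2 • (F₃ * E₃ * L 3 0 (-1))
      + t (-2) • (F₂ * E₂ * L 0 1 (-3))
      + t (-2) • (F₂ * E₂ * L 0 3 (-1)))
    + ((t 1 - t (-1)) ^ 3 * (t 1 + t (-1))) • (t (-2) • (F₁ * F₂ * E₃ * L 1 2 (-1))
      + t (-1) • (F₃ * E₁ * E₂ * L 1 2 (-1)))
    + ((t 1 - t (-1)) ^ 4 * (t 1 + t (-1))) • (t 1 • (F₁ * F₃ * E₁ * E₃ * L 2 1 (-1))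
      + t 1 • (F₃ * F₂ * E₃ * E₂ * L 1 1 (-2)))
    + ((t 1 - t (-1)) ^ 4 * t (-2)) • (F₁ ^ 2 * E₁ ^ 2 * L 2 2 0)

/-- Both elements are homogeneous of degree zero for any grading in which `E_i` and `F_i` have
opposite degrees. -/
theorem phi_mem_of_graded {ι : Type*} [AddCommGroup ι] (W : ι → Submodule R A)
    (hmul : ∀ a b x y, x ∈ W a → y ∈ W b → x * y ∈ W (a + b))
    (t : ℤ → R) {L : ℤ → ℤ → ℤ → A} {E₁ E₂ F₁ F₂ : A} {a b : ι}
    (hL : ∀ i j k, L i j k ∈ W 0) (hE₁ : E₁ ∈ W a) (hE₂ : E₂ ∈ W b) (hF₁ : F₁ ∈ W (-a))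
    (hF₂ : F₂ ∈ W (-b)) :
    phi1 t L E₁ E₂ (rootE t E₁ E₂) F₁ F₂ (rootF t F₁ F₂) ∈ W 0 ∧
      phi2 t L E₁ E₂ (rootE t E₁ E₂) F₁ F₂ (rootF t F₁ F₂) ∈ W 0 := by
  have hm {a b c x y} (hx : x ∈ W a) (hy : y ∈ W b) (hc : c = a + b) : x * y ∈ W c :=
    hc ▸ hmul _ _ _ _ hx hy
  have hE₃ : rootE t E₁ E₂ ∈ W (a + b) :=
    sub_mem (hmul _ _ _ _ hE₁ hE₂) (Submodule.smul_mem _ _ (hm hE₂ hE₁ (by abel)))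
  have hF₃ : rootF t F₁ F₂ ∈ W (-a + -b) :=
    sub_mem (hm hF₂ hF₁ (by abel)) (Submodule.smul_mem _ _ (hmul _ _ _ _ hF₁ hF₂))
  have h2 {F E c i j k} (hF : F ∈ W (-c)) (hE : E ∈ W c) : F * E * L i j k ∈ W 0 :=
    hm (hm hF hE rfl) (hL ..) (by abel)
  have h₁ {i j k} : F₁ * E₁ * L i j k ∈ W 0 := h2 hF₁ hE₁
  have h₂ {i j k} : F₂ * E₂ * L i j k ∈ W 0 := h2 hF₂ hE₂
  have h₃ {i j k} : rootF t F₁ F₂ * rootE t E₁ E₂ * L i j k ∈ W 0 :=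
    hm (hm hF₃ hE₃ rfl) (hL ..) (by abel)
  have hs (c : R) {x} (hx : x ∈ W 0) : c • x ∈ W 0 := Submodule.smul_mem _ _ hx
  constructor
  · exact add_mem (sub_mem (add_mem (hL ..) (hs _ (hL ..))) (hs _ (hL ..)))
      (hs _ (add_mem (add_mem (hs _ h₁) (hs _ h₃)) (hs _ h₂)))
  · refine add_mem (add_mem (add_mem (add_mem
      (sub_mem (add_mem (hL ..) (hs _ (hL ..))) (hs _ (hL ..)))
      (hs _ (add_mem (add_mem (add_mem (add_mem (add_mem (hs _ h₁) h₁) h₃) (hs _ h₃)) (hs _ h₂))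
        (hs _ h₂)))) (hs _ (add_mem (hs _ ?_) (hs _ ?_)))) (hs _ (add_mem (hs _ ?_) (hs _ ?_))))
        (hs _ ?_)
    · exact hm (hm (hm hF₁ hF₂ rfl) hE₃ rfl) (hL ..) (by abel)
    · exact hm (hm (hm hF₃ hE₁ rfl) hE₂ rfl) (hL ..) (by abel)
    · exact hm (hm (hm (hm hF₁ hF₃ rfl) hE₁ rfl) hE₃ rfl) (hL ..) (by abel)
    · exact hm (hm (hm (hm hF₃ hF₂ rfl) hE₃ rfl) hE₂ rfl) (hL ..) (by abel)
    · rw [pow_two, pow_two]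
      exact hm (hm (hm hF₁ hF₁ rfl) (hm hE₁ hE₁ rfl) rfl) (hL ..) (by abel)

/-- The defining relations of `U_q(gl_{2|1})`, with `t n` for `qⁿ` and `L a b c` for
`q ^ (a K₁ + b K₂ + c K₃)`. -/
structure Relations (t : ℤ → R) (L : ℤ → ℤ → ℤ → A) (E₁ E₂ F₁ F₂ : A) : Prop where
  t_zero : t 0 = 1
  t_add : ∀ m n, t (m + n) = t m * t n
  isUnit_two : IsUnit (t 1 + t (-1))
  L_mul_L : ∀ a b c a' b' c', L a b c * L a' b' c' = L (a + a') (b + b') (c + c')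
  L_mul_E₁ : ∀ a b c, L a b c * E₁ = t (a - b) • (E₁ * L a b c)
  L_mul_E₂ : ∀ a b c, L a b c * E₂ = t (b - c) • (E₂ * L a b c)
  F₁_mul_L : ∀ a b c, F₁ * L a b c = t (a - b) • (L a b c * F₁)
  F₂_mul_L : ∀ a b c, F₂ * L a b c = t (b - c) • (L a b c * F₂)
  E₁_F₁ : (t 1 - t (-1)) • (E₁ * F₁ - F₁ * E₁) = L 1 (-1) 0 - L (-1) 1 0
  E₂_F₂ : (t 1 - t (-1)) • (E₂ * F₂ + F₂ * E₂) = L 0 1 1 - L 0 (-1) (-1)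
  E₁_F₂ : E₁ * F₂ = F₂ * E₁
  E₂_F₁ : E₂ * F₁ = F₁ * E₂
  E₂_mul_E₂ : E₂ * E₂ = 0
  F₂_mul_F₂ : F₂ * F₂ = 0
  serreE : E₁ * rootE t E₁ E₂ = t 1 • (rootE t E₁ E₂ * E₁)
  serreF : rootF t F₁ F₂ * F₁ = t 1 • (F₁ * rootF t F₁ F₂)

/-! ### Consequences of the relations and the anti-automorphism exchanging `E` and `F` -/

namespace Relations

variable {t : ℤ → R} {L : ℤ → ℤ → ℤ → A} {E₁ E₂ F₁ F₂ : A}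

open MulOpposite in
-- The ordinary opposite algebra suffices, without super signs, because the odd relation between
-- `E₂` and `F₂` is an anticommutator. The chosen forms of `rootE` and `rootF` correspond under the
-- exchange, so the Serre relations match too.
theorem opposite (h : Relations t L E₁ E₂ F₁ F₂) :
    Relations t (fun a b c => op (L a b c)) (op F₁) (op F₂) (op E₁) (op E₂) where
  t_zero := h.t_zero
  t_add := h.t_add
  isUnit_two := h.isUnit_two
  L_mul_L a b c a' b' c' := by rw [← op_mul, h.L_mul_L, add_comm a, add_comm b, add_comm c]
  L_mul_E₁ a b c := by rw [← op_mul, h.F₁_mul_L, op_smul, op_mul]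
  L_mul_E₂ a b c := by rw [← op_mul, h.F₂_mul_L, op_smul, op_mul]
  F₁_mul_L a b c := by rw [← op_mul, h.L_mul_E₁, op_smul, op_mul]
  F₂_mul_L a b c := by rw [← op_mul, h.L_mul_E₂, op_smul, op_mul]
  E₁_F₁ := congrArg MulOpposite.op h.E₁_F₁
  E₂_F₂ := congrArg MulOpposite.op h.E₂_F₂
  E₁_F₂ := congrArg MulOpposite.op h.E₂_F₁
  E₂_F₁ := congrArg MulOpposite.op h.E₁_F₂
  E₂_mul_E₂ := congrArg MulOpposite.op h.F₂_mul_F₂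
  F₂_mul_F₂ := congrArg MulOpposite.op h.E₂_mul_E₂
  serreE := congrArg MulOpposite.op h.serreF
  serreF := congrArg MulOpposite.op h.serreE

theorem t_mul_t_neg (h : Relations t L E₁ E₂ F₁ F₂) (n : ℤ) : t n * t (-n) = 1 := by
  rw [← h.t_add, add_neg_cancel, h.t_zero]

theorem t_neg_mul_t (h : Relations t L E₁ E₂ F₁ F₂) (n : ℤ) : t (-n) * t n = 1 := by
  rw [mul_comm, h.t_mul_t_neg]

theorem E₃_mul_E₁ (h : Relations t L E₁ E₂ F₁ F₂) :
    rootE t E₁ E₂ * E₁ = t (-1) • (E₁ * rootE t E₁ E₂) := by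
  rw [h.serreE, smul_smul, h.t_neg_mul_t, one_smul]

theorem E₂_mul_E₁ (h : Relations t L E₁ E₂ F₁ F₂) :
    E₂ * E₁ = t 1 • (E₁ * E₂) - t 1 • rootE t E₁ E₂ := by
  rw [rootE, smul_sub, smul_smul, h.t_mul_t_neg, one_smul, sub_sub_cancel]

/-- Since `E₂ * E₂ = 0`, both products are multiples of `E₂ * E₁ * E₂`. -/
theorem E₂_mul_E₃ (h : Relations t L E₁ E₂ F₁ F₂) :
    E₂ * rootE t E₁ E₂ = -(t 1 • (rootE t E₁ E₂ * E₂)) := by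
  have h1 := h.t_mul_t_neg 1
  simp only [rootE, mul_sub, sub_mul, mul_smul_comm, smul_mul_assoc, mul_assoc, h.E₂_mul_E₂,
    mul_assoc_of_eq h.E₂_mul_E₂, mul_zero, zero_mul]
  match_scalars
  grind

/-- Expand the left factor and move `E₁` and `E₂` through the right one: the square equals `-t 1 ^
2` times itself. Here `1 + t 1 ^ 2 = t 1 * (t 1 + t (-1))` is a unit, which is the purpose of
`isUnit_two`. -/
theorem E₃_mul_E₃ (h : Relations t L E₁ E₂ F₁ F₂) :
    rootE t E₁ E₂ * rootE t E₁ E₂ = 0 := by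
  have h1 := h.t_mul_t_neg 1
  have key : rootE t E₁ E₂ * rootE t E₁ E₂ =
      -(t 1 ^ 2 • (rootE t E₁ E₂ * (E₁ * E₂ - t (-1) • (E₂ * E₁)))) := by
    conv_lhs => arg 1; rw [rootE]
    simp only [mul_sub, sub_mul, mul_smul_comm, smul_mul_assoc, mul_assoc, h.E₂_mul_E₃, h.serreE,
      mul_assoc_of_eq h.E₂_mul_E₃, mul_assoc_of_eq h.serreE, mul_neg, neg_mul]
    module
  rw [← rootE] at key
  have h2 : (t 1 * (t 1 + t (-1))) • (rootE t E₁ E₂ * rootE t E₁ E₂) = 0 := by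
    rw [mul_add, h1, ← pow_two, add_smul, one_smul]
    nth_rewrite 2 [key]
    rw [add_neg_cancel]
  have hu : IsUnit (t 1 * (t 1 + t (-1))) := (IsUnit.of_mul_eq_one _ h1).mul h.isUnit_two
  exact hu.smul_eq_zero.1 h2

theorem L_mul_E₃ (h : Relations t L E₁ E₂ F₁ F₂) (a b c : ℤ) :
    L a b c * rootE t E₁ E₂ = t (a - c) • (rootE t E₁ E₂ * L a b c) := by
  have h1 : t (a - c) = t (a - b) * t (b - c) := by rw [← h.t_add]; congr 1; ring
  simp only [rootE, mul_sub, sub_mul, mul_smul_comm, smul_mul_assoc, mul_assoc, h.L_mul_E₁,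
    h.L_mul_E₂, mul_assoc_of_eq (h.L_mul_E₁ a b c), mul_assoc_of_eq (h.L_mul_E₂ a b c), h1]
  module

theorem L_mul_F₁ (h : Relations t L E₁ E₂ F₁ F₂) (a b c : ℤ) :
    L a b c * F₁ = t (b - a) • (F₁ * L a b c) := by
  rw [h.F₁_mul_L, smul_smul, ← neg_sub, h.t_neg_mul_t, one_smul]

theorem L_mul_F₂ (h : Relations t L E₁ E₂ F₁ F₂) (a b c : ℤ) :
    L a b c * F₂ = t (c - b) • (F₂ * L a b c) := by
  rw [h.F₂_mul_L, smul_smul, ← neg_sub, h.t_neg_mul_t, one_smul]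

theorem L_mul_F₃ (h : Relations t L E₁ E₂ F₁ F₂) (a b c : ℤ) :
    L a b c * rootF t F₁ F₂ = t (c - a) • (rootF t F₁ F₂ * L a b c) := by
  have h1 : t (c - a) = t (c - b) * t (b - a) := by rw [← h.t_add]; congr 1; ring
  simp only [rootF, mul_sub, sub_mul, mul_smul_comm, smul_mul_assoc, mul_assoc, h.L_mul_F₁,
    h.L_mul_F₂, mul_assoc_of_eq (h.L_mul_F₁ a b c), mul_assoc_of_eq (h.L_mul_F₂ a b c), h1]
  module

/-- The commutator with `F₁` gives two Cartan terms on either side of `F₂`. After moving them to the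
right, the `L 1 (-1) 0` parts cancel, and the coefficient left on `L (-1) 1 0` again contains `t 1 -
t (-1)`, which rescales `F₂`. -/
theorem E₁_mul_F₃ (h : Relations t L E₁ E₂ F₁ F₂) :
    E₁ * (t 1 - t (-1)) • rootF t F₁ F₂ = (t 1 - t (-1)) • rootF t F₁ F₂ * E₁ -
      t (-1) • ((t 1 - t (-1)) • F₂ * L (-1) 1 0) := by
  have h1 := h.t_mul_t_neg 1
  have e : (t 1 - t (-1)) • (E₁ * F₁) = (t 1 - t (-1)) • (F₁ * E₁) +
      (L 1 (-1) 0 - L (-1) 1 0) := by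
    rw [← h.E₁_F₁]; module
  have e' := mul_assoc_of_eq h.E₁_F₂
  have a1 : F₂ * ((t 1 - t (-1)) • (E₁ * F₁)) = _ := congrArg (F₂ * ·) e
  have a2 : (t 1 - t (-1)) • (E₁ * F₁) * F₂ = _ := congrArg (· * F₂) e
  simp only [mul_add, add_mul, mul_sub, sub_mul, mul_smul_comm, smul_mul_assoc, mul_assoc,
    h.L_mul_F₂, h.E₁_F₂, Int.reduceNeg, zero_sub, neg_neg] at a1 a2
  simp only [rootF, mul_sub, sub_mul, mul_smul_comm, smul_mul_assoc, mul_assoc, smul_sub, e',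
    smul_comm (t 1 - t (-1)) (t (-1)), a1, a2]
  match_scalars <;> grind

/-- The same mechanism as for `E₁`, except that now the `L 0 (-1) (-1)` parts cancel. -/
theorem E₂_mul_F₃ (h : Relations t L E₁ E₂ F₁ F₂) :
    E₂ * (t 1 - t (-1)) • rootF t F₁ F₂ = -((t 1 - t (-1)) • rootF t F₁ F₂ * E₂) +
      (t 1 - t (-1)) • F₁ * L 0 1 1 := by
  have h1 := h.t_mul_t_neg 1
  have e : (t 1 - t (-1)) • (E₂ * F₂) =
      -((t 1 - t (-1)) • (F₂ * E₂)) + (L 0 1 1 - L 0 (-1) (-1)) := by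
    rw [← h.E₂_F₂]; module
  have e' := mul_assoc_of_eq h.E₂_F₁
  have a1 : F₁ * ((t 1 - t (-1)) • (E₂ * F₂)) = _ := congrArg (F₁ * ·) e
  have a2 : (t 1 - t (-1)) • (E₂ * F₂) * F₁ = _ := congrArg (· * F₁) e
  simp only [mul_add, add_mul, mul_sub, sub_mul, mul_smul_comm, smul_mul_assoc, mul_assoc,
    neg_mul, mul_neg, h.L_mul_F₁, h.E₂_F₁, Int.reduceNeg, sub_zero] at a1 a2
  simp only [rootF, mul_sub, sub_mul, mul_smul_comm, smul_mul_assoc, mul_assoc, smul_sub, e',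
    smul_comm (t 1 - t (-1)) (t (-1)), a1, a2]
  match_scalars <;> grind

theorem normalOrder (h : Relations t L E₁ E₂ F₁ F₂) :
    NormalOrder t L E₁ E₂ (rootE t E₁ E₂) ((t 1 - t (-1)) • F₁) ((t 1 - t (-1)) • F₂)
      ((t 1 - t (-1)) • rootF t F₁ F₂) where
  t_zero := h.t_zero
  t_add := h.t_add
  L_mul_L := h.L_mul_L
  L_mul_x₁ := h.L_mul_E₁
  L_mul_x₂ := h.L_mul_E₂
  L_mul_x₃ := h.L_mul_E₃
  x₃_mul_x₁ := h.E₃_mul_E₁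
  x₂_mul_x₁ := h.E₂_mul_E₁
  x₂_mul_x₃ := h.E₂_mul_E₃
  x₂_mul_x₂ := h.E₂_mul_E₂
  x₃_mul_x₃ := h.E₃_mul_E₃
  y₂_mul_y₂ := by rw [smul_mul_assoc, mul_smul_comm, h.F₂_mul_F₂, smul_zero, smul_zero]
  x₁_mul_y₁ := by
    rw [mul_smul_comm, smul_mul_assoc, add_sub_assoc, ← h.E₁_F₁, smul_sub, add_sub_cancel]
  x₁_mul_y₂ := by rw [mul_smul_comm, smul_mul_assoc, h.E₁_F₂]
  x₂_mul_y₁ := by rw [mul_smul_comm, smul_mul_assoc, h.E₂_F₁]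
  x₂_mul_y₂ := by
    rw [mul_smul_comm, smul_mul_assoc, add_sub_assoc, ← h.E₂_F₂, smul_add,
      neg_add_cancel_comm_assoc]
  x₁_mul_y₃ := h.E₁_mul_F₃
  x₂_mul_y₃ := h.E₂_mul_F₃
  L_mul_y₁ a b c := by rw [mul_smul_comm, smul_mul_assoc, h.L_mul_F₁, smul_comm]
  L_mul_y₂ a b c := by rw [mul_smul_comm, smul_mul_assoc, h.L_mul_F₂, smul_comm]
  L_mul_y₃ a b c := by rw [mul_smul_comm, smul_mul_assoc, h.L_mul_F₃, smul_comm]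

theorem phi1_eq_scaledPhi1 (t : ℤ → R) (L : ℤ → ℤ → ℤ → A) (E₁ E₂ E₃ F₁ F₂ F₃ : A) :
    phi1 t L E₁ E₂ E₃ F₁ F₂ F₃ = scaledPhi1 t L E₁ E₂ E₃ ((t 1 - t (-1)) • F₁)
      ((t 1 - t (-1)) • F₂) ((t 1 - t (-1)) • F₃) := by
  simp only [phi1, scaledPhi1, smul_mul_assoc]
  module

theorem phi2_eq_scaledPhi2 (t : ℤ → R) (L : ℤ → ℤ → ℤ → A) (E₁ E₂ E₃ F₁ F₂ F₃ : A) :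
    phi2 t L E₁ E₂ E₃ F₁ F₂ F₃ = scaledPhi2 t L E₁ E₂ E₃ ((t 1 - t (-1)) • F₁)
      ((t 1 - t (-1)) • F₂) ((t 1 - t (-1)) • F₃) := by
  simp only [phi2, scaledPhi2, smul_mul_assoc, mul_smul_comm, pow_two, mul_assoc]
  module

theorem commute_E (h : Relations t L E₁ E₂ F₁ F₂) :
    (Commute E₁ (phi1 t L E₁ E₂ (rootE t E₁ E₂) F₁ F₂ (rootF t F₁ F₂)) ∧
      Commute E₂ (phi1 t L E₁ E₂ (rootE t E₁ E₂) F₁ F₂ (rootF t F₁ F₂))) ∧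
    (Commute E₁ (phi2 t L E₁ E₂ (rootE t E₁ E₂) F₁ F₂ (rootF t F₁ F₂)) ∧
      Commute E₂ (phi2 t L E₁ E₂ (rootE t E₁ E₂) F₁ F₂ (rootF t F₁ F₂))) := by
  rw [phi1_eq_scaledPhi1, phi2_eq_scaledPhi2]
  exact h.normalOrder.commute_scaledPhi

/-- Reversal only moves the Cartan factor to the left, and it commutes with the weight-zero product
next to it. -/
theorem phi1_op (h : Relations t L E₁ E₂ F₁ F₂) :
    phi1 t (fun a b c => MulOpposite.op (L a b c)) (MulOpposite.op F₁) (MulOpposite.op F₂)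
      (MulOpposite.op (rootF t F₁ F₂)) (MulOpposite.op E₁) (MulOpposite.op E₂)
      (MulOpposite.op (rootE t E₁ E₂)) =
    MulOpposite.op (phi1 t L E₁ E₂ (rootE t E₁ E₂) F₁ F₂ (rootF t F₁ F₂)) := by
  apply MulOpposite.unop_injective
  simp only [phi1, MulOpposite.unop_add, MulOpposite.unop_sub, MulOpposite.unop_smul,
    MulOpposite.unop_mul, MulOpposite.unop_op]
  have hq := h.t_mul_t_neg 1
  have hq2 := h.t_mul_t_neg 2
  simp only [smul_mul_assoc, mul_smul_comm, mul_assoc, h.L_mul_E₁, h.L_mul_E₂, h.L_mul_E₃,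
      fun a b c => mul_assoc_of_eq (h.L_mul_F₁ a b c),
      fun a b c => mul_assoc_of_eq (h.L_mul_F₂ a b c),
      fun a b c => mul_assoc_of_eq (h.L_mul_F₃ a b c),
      Int.reduceSub, Int.reduceNeg, h.t_zero]
  match_scalars <;> grind

theorem F₃_mul_F₁ (h : Relations t L E₁ E₂ F₁ F₂) :
    rootF t F₁ F₂ * F₁ = t 1 • (F₁ * rootF t F₁ F₂) := h.serreF

theorem F₂_mul_F₁ (t : ℤ → R) (F₁ F₂ : A) :
    F₂ * F₁ = t (-1) • (F₁ * F₂) + rootF t F₁ F₂ := by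
  rw [rootF, add_sub_cancel]

theorem F₂_mul_F₃ (h : Relations t L E₁ E₂ F₁ F₂) :
    F₂ * rootF t F₁ F₂ = -(t (-1) • (rootF t F₁ F₂ * F₂)) := by
  simp only [rootF, mul_sub, sub_mul, mul_smul_comm, smul_mul_assoc, mul_assoc, h.F₂_mul_F₂,
    mul_assoc_of_eq h.F₂_mul_F₂, mul_zero, zero_mul]
  module

/-- The two terms with coefficient `(t 1 - t (-1)) ^ 3 * (t 1 + t (-1))` are exchanged. Reordering
`E₂ * E₁` in one and `F₂ * F₁` in the other creates multiples of `rootF * rootE` that cancel; in the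
quartic terms the reordering scalars multiply to one. -/
theorem phi2_op (h : Relations t L E₁ E₂ F₁ F₂) :
    phi2 t (fun a b c => MulOpposite.op (L a b c)) (MulOpposite.op F₁) (MulOpposite.op F₂)
      (MulOpposite.op (rootF t F₁ F₂)) (MulOpposite.op E₁) (MulOpposite.op E₂)
      (MulOpposite.op (rootE t E₁ E₂)) =
    MulOpposite.op (phi2 t L E₁ E₂ (rootE t E₁ E₂) F₁ F₂ (rootF t F₁ F₂)) := by
  apply MulOpposite.unop_injective
  simp only [phi2, pow_two, MulOpposite.unop_add, MulOpposite.unop_sub, MulOpposite.unop_smul,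
    MulOpposite.unop_mul, MulOpposite.unop_op]
  have hq := h.t_mul_t_neg 1
  have t2 : t 2 = t 1 * t 1 := by rw [← h.t_add]; norm_num
  have s2 : t (-2) = t (-1) * t (-1) := by rw [← h.t_add]; norm_num
  have t3 : t 3 = t 1 * t 2 := by rw [← h.t_add]; norm_num
  have s3 : t (-3) = t (-1) * t (-2) := by rw [← h.t_add]; norm_num
  have t4 : t 4 = t 2 * t 2 := by rw [← h.t_add]; norm_num
  have s4 : t (-4) = t (-2) * t (-2) := by rw [← h.t_add]; norm_num
  simp only [smul_mul_assoc, mul_smul_comm, mul_assoc, h.L_mul_E₁, h.L_mul_E₂, h.L_mul_E₃,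
      mul_sub, mul_add, sub_mul, add_mul, mul_neg, neg_mul, smul_neg,
      fun a b c => mul_assoc_of_eq (h.L_mul_E₁ a b c),
      fun a b c => mul_assoc_of_eq (h.L_mul_E₂ a b c),
      fun a b c => mul_assoc_of_eq (h.L_mul_E₃ a b c),
      fun a b c => mul_assoc_of_eq (h.L_mul_F₁ a b c),
      fun a b c => mul_assoc_of_eq (h.L_mul_F₂ a b c),
      fun a b c => mul_assoc_of_eq (h.L_mul_F₃ a b c),
      mul_assoc_of_eq h.E₃_mul_E₁, mul_assoc_of_eq h.E₂_mul_E₁, mul_assoc_of_eq h.E₂_mul_E₃,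
      mul_assoc_of_eq h.F₃_mul_F₁, mul_assoc_of_eq (F₂_mul_F₁ t F₁ F₂), mul_assoc_of_eq h.F₂_mul_F₃,
      Int.reduceSub, Int.reduceNeg, h.t_zero]
  match_scalars <;> grind

theorem commute_F (h : Relations t L E₁ E₂ F₁ F₂) :
    (Commute F₁ (phi1 t L E₁ E₂ (rootE t E₁ E₂) F₁ F₂ (rootF t F₁ F₂)) ∧
      Commute F₂ (phi1 t L E₁ E₂ (rootE t E₁ E₂) F₁ F₂ (rootF t F₁ F₂))) ∧
    (Commute F₁ (phi2 t L E₁ E₂ (rootE t E₁ E₂) F₁ F₂ (rootF t F₁ F₂)) ∧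
      Commute F₂ (phi2 t L E₁ E₂ (rootE t E₁ E₂) F₁ F₂ (rootF t F₁ F₂))) := by
  have key := h.opposite.commute_E
  rw [show rootE t (MulOpposite.op F₁) (MulOpposite.op F₂) = MulOpposite.op (rootF t F₁ F₂) from rfl,
    show rootF t (MulOpposite.op E₁) (MulOpposite.op E₂) = MulOpposite.op (rootE t E₁ E₂) from rfl,
    h.phi1_op, h.phi2_op] at key
  exact ⟨⟨MulOpposite.commute_op.1 key.1.1, MulOpposite.commute_op.1 key.1.2⟩,
    MulOpposite.commute_op.1 key.2.1, MulOpposite.commute_op.1 key.2.2⟩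

end Relations

end Abstract

/-! ### The complete free algebra modulo the relations -/

theorem toU_surjective : Function.Surjective toU := RingCon.mkₐ_surjective _

theorem toU_eq_zero_iff (x : CFree) : toU x = 0 ↔ x ∈ relIdeal := by
  rw [TwoSidedIdeal.mem_iff]
  exact RingCon.eq _

theorem toU_relator {x : CFree} (hx : Relator x) : toU x = 0 := by
  rw [toU_eq_zero_iff, relIdeal, TwoSidedIdeal.mem_iInf]
  exact fun n => TwoSidedIdeal.mem_sup_left (TwoSidedIdeal.subset_span hx)

/-- `U` is `ħ`-adically separated. -/
theorem eq_zero_of_forall_hbar_pow (u : U)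
    (h : ∀ n : ℕ, ∃ w : U, u = (PowerSeries.X ^ n : ℂ⟦X⟧) • w) : u = 0 := by
  obtain ⟨x, rfl⟩ := toU_surjective u
  rw [toU_eq_zero_iff, relIdeal, TwoSidedIdeal.mem_iInf]
  intro n
  obtain ⟨w, hw⟩ := h n
  obtain ⟨z, rfl⟩ := toU_surjective w
  rw [← map_smul, ← sub_eq_zero, ← map_sub, toU_eq_zero_iff, relIdeal,
    TwoSidedIdeal.mem_iInf] at hw
  rw [← sub_add_cancel x ((PowerSeries.X ^ n : ℂ⟦X⟧) • z)]
  refine TwoSidedIdeal.add_mem _ (hw n) (TwoSidedIdeal.mem_sup_right ?_)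
  rw [Algebra.smul_def]
  exact TwoSidedIdeal.mul_mem_right _ _ _ (TwoSidedIdeal.subset_span rfl)

/-- The image in `U` of an element of the free complex algebra. -/
def constU : FreeGen →+* U :=
  (toU : CFree →+* U).comp (CFree.ofSeries.toRingHom.comp PowerSeries.C)

theorem constU_apply (a : FreeGen) : constU a = toU (CFree.ofSeries (PowerSeries.C a)) := rfl

theorem ofSeries_map_algebraMap (c : ℂ⟦X⟧) :
    CFree.ofSeries (PowerSeries.map (algebraMap ℂ FreeGen) c) = algebraMap ℂ⟦X⟧ CFree c := rfl

theorem constU_algebraMap (c : ℂ) :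
    constU (algebraMap ℂ FreeGen c) = algebraMap ℂ⟦X⟧ U (PowerSeries.C c) := by
  rw [constU_apply, ← PowerSeries.map_C, ofSeries_map_algebraMap, AlgHom.commutes]

theorem constU_smul (c : ℂ) (a : FreeGen) :
    constU (c • a) = (PowerSeries.C c : ℂ⟦X⟧) • constU a := by
  rw [Algebra.smul_def, map_mul, constU_algebraMap, ← Algebra.smul_def]

/-- Splitting off the constant term is the inductive step of every `ħ`-adic argument below. -/
theorem toU_eq_constU_add (f : FreeGen⟦X⟧) : toU (CFree.ofSeries f) =
    constU (PowerSeries.coeff 0 f) +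
      (PowerSeries.X : ℂ⟦X⟧) • toU (CFree.ofSeries (divHbar f)) := by
  have h0 : PowerSeries.coeff 0 (f - PowerSeries.C (PowerSeries.coeff 0 f)) = 0 := by simp
  have h1 : divHbar (f - PowerSeries.C (PowerSeries.coeff 0 f)) = divHbar f := by
    ext n; simp [divHbar]
  have h := CFree.hbar_smul_divHbar _ h0
  rw [h1, map_sub] at h
  rw [constU_apply, ← map_smul, h, map_sub, add_sub_cancel]

theorem toU_eq_zero_of_constU_coeff (f : FreeGen⟦X⟧)
    (h : ∀ n, constU (PowerSeries.coeff n f) = 0) : toU (CFree.ofSeries f) = 0 := by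
  refine eq_zero_of_forall_hbar_pow _ fun n => ?_
  induction n generalizing f with
  | zero => exact ⟨_, by rw [pow_zero, one_smul]⟩
  | succ n ih =>
    obtain ⟨w, hw⟩ := ih (divHbar f) fun k => by rw [divHbar, PowerSeries.coeff_mk, h]
    exact ⟨w, by rw [toU_eq_constU_add, h, zero_add, hw, smul_smul, pow_succ']⟩

/-- The image in `U` of a series depends only on the images of its coefficients. -/
theorem toU_ofSeries_congr {f g : FreeGen⟦X⟧}
    (h : ∀ n, constU (PowerSeries.coeff n f) = constU (PowerSeries.coeff n g)) :
    toU (CFree.ofSeries f) = toU (CFree.ofSeries g) := by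
  rw [← sub_eq_zero, ← map_sub, ← map_sub]
  refine toU_eq_zero_of_constU_coeff _ fun n => ?_
  rw [map_sub, map_sub, h, sub_self]

/-- An element that commutes with the generators is central. -/
theorem mem_center_of_commute_gen (u : U) (h : ∀ g, Commute u (toU (CFree.gen g))) :
    u ∈ Subalgebra.center ℂ⟦X⟧ U := by
  have hc (a : FreeGen) : Commute u (constU a) := by
    induction a using FreeAlgebra.induction with
    | grade0 c => rw [constU_algebraMap]; exact (Algebra.commutes _ u).symm
    | grade1 g => exact h g
    | mul a b ha hb => rw [map_mul]; exact ha.mul_right hb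
    | add a b ha hb => rw [map_add]; exact ha.add_right hb
  rw [Subalgebra.mem_center_iff]
  intro w
  obtain ⟨x, rfl⟩ := toU_surjective w
  obtain ⟨f, rfl⟩ := CFree.ofSeries.surjective x
  rw [← sub_eq_zero]
  refine eq_zero_of_forall_hbar_pow _ fun n => ?_
  induction n generalizing f with
  | zero => exact ⟨_, by rw [pow_zero, one_smul]⟩
  | succ n ih =>
    -- The constant term commutes with `u`, so the commutator with `f` is `ħ` times that with
    -- `divHbar f`.
    obtain ⟨w, hw⟩ := ih (divHbar f)
    refine ⟨w, ?_⟩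
    rw [toU_eq_constU_add, add_mul, mul_add, (hc _).eq, add_sub_add_left_eq_sub, mul_smul_comm,
      smul_mul_assoc, ← smul_sub, hw, smul_smul, pow_succ']

/-! ### Formal exponentials -/

theorem coeff_qExp {A : Type*} [Ring A] [Algebra ℂ A] (a : A) (n : ℕ) :
    PowerSeries.coeff n (qExp a) = ((n.factorial : ℂ)⁻¹) • a ^ n := PowerSeries.coeff_mk _ _

theorem inv_factorial_mul_choose {i j n : ℕ} (h : i + j = n) :
    ((n.factorial : ℂ)⁻¹) * (n.choose i : ℂ) = (i.factorial : ℂ)⁻¹ * (j.factorial : ℂ)⁻¹ := by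
  subst h
  have h2 : (((i + j).choose i : ℕ) : ℂ) * i.factorial * j.factorial = (i + j).factorial := by
    rw [Nat.choose_symm_add]
    exact_mod_cast Nat.add_choose_mul_factorial_mul_factorial i j
  have hi : (i.factorial : ℂ) ≠ 0 := by exact_mod_cast i.factorial_ne_zero
  have hj : (j.factorial : ℂ) ≠ 0 := by exact_mod_cast j.factorial_ne_zero
  have hn : ((i + j).factorial : ℂ) ≠ 0 := by exact_mod_cast (i + j).factorial_ne_zero
  field_simp
  linear_combination h2

theorem qExp_mul_qExp {A : Type*} [Ring A] [Algebra ℂ A] {a b : A} (h : Commute a b) :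
    qExp a * qExp b = qExp (a + b) := by
  ext n
  rw [PowerSeries.coeff_mul, coeff_qExp, h.add_pow', Finset.smul_sum]
  refine Finset.sum_congr rfl fun p hp => ?_
  rw [coeff_qExp, coeff_qExp, smul_mul_smul_comm, ← Nat.cast_smul_eq_nsmul ℂ, smul_smul,
    inv_factorial_mul_choose (Finset.HasAntidiagonal.mem_antidiagonal.1 hp)]

/-- `qExp_mul_qExp` does not apply: the `K_i` do not commute in the free algebra, only in `U`. The
binomial theorem is therefore used on the images of the coefficients. -/
theorem toU_qpow_mul_qpow {a b : FreeGen} (h : Commute (constU a) (constU b)) :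
    toU (CFree.qpow a) * toU (CFree.qpow b) = toU (CFree.qpow (a + b)) := by
  rw [← map_mul, CFree.qpow, CFree.qpow, ← map_mul]
  refine toU_ofSeries_congr fun n => ?_
  rw [PowerSeries.coeff_mul, coeff_qExp, constU_smul, map_pow, map_add, h.add_pow',
    Finset.smul_sum, map_sum]
  refine Finset.sum_congr rfl fun p hp => ?_
  rw [coeff_qExp, coeff_qExp, smul_mul_smul_comm, constU_smul, ← Nat.cast_smul_eq_nsmul ℂ⟦X⟧,
    smul_smul, map_mul constU, map_pow, map_pow,
    ← inv_factorial_mul_choose (Finset.HasAntidiagonal.mem_antidiagonal.1 hp), map_mul,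
    map_natCast]

theorem toU_qpow_semiconj {a b : FreeGen} {e : FreeGen}
    (h : SemiconjBy (constU e) (constU b) (constU a)) :
    toU (CFree.qpow a) * constU e = constU e * toU (CFree.qpow b) := by
  rw [constU_apply, ← map_mul, CFree.qpow, CFree.qpow, ← map_mul, ← map_mul, ← map_mul]
  refine toU_ofSeries_congr fun n => ?_
  rw [PowerSeries.coeff_mul_C, PowerSeries.coeff_C_mul, map_mul, map_mul, coeff_qExp, coeff_qExp,
    constU_smul, constU_smul, map_pow, map_pow, smul_mul_assoc, mul_smul_comm,
    (h.pow_right n).eq]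

theorem qpow_algebraMap (c : ℂ) :
    CFree.qpow (algebraMap ℂ FreeGen c) = algebraMap ℂ⟦X⟧ CFree (qc c) := by
  rw [CFree.qpow, ← ofSeries_map_algebraMap]
  congr 1
  ext n
  rw [PowerSeries.coeff_map, coeff_qExp, coeff_qExp, smul_eq_mul, map_mul, map_pow,
    Algebra.smul_def]

theorem toU_qpow_add_algebraMap (a : FreeGen) (c : ℂ) :
    toU (CFree.qpow (a + algebraMap ℂ FreeGen c)) = qc c • toU (CFree.qpow a) := by
  rw [CFree.qpow, ← qExp_mul_qExp (Algebra.commutes c a).symm, map_mul, map_mul]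
  change toU (CFree.qpow a) * toU (CFree.qpow _) = _
  rw [qpow_algebraMap, AlgHom.commutes, ← Algebra.commutes, ← Algebra.smul_def]

/-- If `a` acts on a vector by the scalar `c`, then `q ^ a` acts by `q ^ c`. -/
theorem toU_qpow_smul_of_constU_smul {V : Type*} [AddCommGroup V] [Module ℂ⟦X⟧ V] [Module U V]
    [IsScalarTower ℂ⟦X⟧ U V] {a : FreeGen} {c : ℂ} {v : V}
    (h : constU a • v = (PowerSeries.C c : ℂ⟦X⟧) • v) :
    toU (CFree.qpow a) • v = qc c • v := by
  -- `V` need not be `ħ`-adically separated, so coefficientwise comparison on `v` is not available.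
  -- Instead `q^a - q^c` is factored with `a - c` on the right, through the geometric sum for `aⁿ -
  -- cⁿ`, and `a - c` kills `v`.
  have key : qExp a - qExp (algebraMap ℂ FreeGen c) = PowerSeries.mk (fun n =>
      ((n.factorial : ℂ)⁻¹) • ∑ i ∈ Finset.range n, a ^ i * algebraMap ℂ FreeGen c ^ (n - 1 - i)) *
      PowerSeries.C (a - algebraMap ℂ FreeGen c) := by
    ext n
    rw [PowerSeries.coeff_mul_C, PowerSeries.coeff_mk, smul_mul_assoc,
      Commute.geom_sum₂_mul (Algebra.commutes c a).symm, map_sub, coeff_qExp, coeff_qExp, smul_sub]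
  have h0 : constU (a - algebraMap ℂ FreeGen c) • v = 0 := by
    rw [map_sub, constU_algebraMap, sub_smul, h, algebraMap_smul, sub_self]
  have h1 := congrArg (fun f => toU (CFree.ofSeries f) • v) key
  simp only [map_sub, map_mul, mul_smul, ← constU_apply, sub_smul] at h1 h0
  rw [h0, smul_zero, sub_eq_zero] at h1
  change toU (CFree.qpow a) • v = toU (CFree.qpow _) • v at h1
  rw [h1, qpow_algebraMap, AlgHom.commutes, algebraMap_smul]

/-! ### The relations in `U` -/

section Serre

variable {R A : Type*} [CommRing R] [Ring A] [Algebra R A]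

/-- The expanded Serre expression is symmetric in `q` and `r`. This passes from the inner
`q`-bracket of the relator to the inner `q⁻¹`-bracket of `rootE`. -/
theorem serre_left {q r : R} {x y : A}
    (h : x * (x * y - q • (y * x)) - r • ((x * y - q • (y * x)) * x) = 0) :
    x * (x * y - r • (y * x)) = q • ((x * y - r • (y * x)) * x) := by
  rw [← sub_eq_zero, ← h]
  simp only [mul_sub, sub_mul, mul_smul_comm, smul_mul_assoc, mul_assoc]
  match_scalars <;> grind

/-- When `q * r = 1` the Serre expression is also symmetric under reversing words. -/
theorem serre_right {q r : R} (hq : q * r = 1) {x y : A}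
    (h : x * (x * y - r • (y * x)) - q • ((x * y - r • (y * x)) * x) = 0) :
    (y * x - r • (x * y)) * x = q • (x * (y * x - r • (x * y))) := by
  rw [← sub_eq_zero, ← h]
  simp only [mul_sub, sub_mul, mul_smul_comm, smul_mul_assoc, mul_assoc]
  match_scalars <;> grind

end Serre

theorem qc_zero : qc 0 = 1 := by
  ext n
  rw [coeff_qExp, PowerSeries.coeff_one]
  cases n <;> simp

theorem qc_add (a b : ℂ) : qc (a + b) = qc a * qc b := (qExp_mul_qExp (Commute.all a b)).symm

theorem qc_mul_qc_neg (a : ℂ) : qc a * qc (-a) = 1 := by rw [← qc_add, add_neg_cancel, qc_zero]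

theorem isUnit_qTwo : IsUnit qTwo := by
  rw [PowerSeries.isUnit_iff_constantCoeff, ← PowerSeries.coeff_zero_eq_constantCoeff_apply,
    qTwo, map_add, coeff_qExp, coeff_qExp]
  norm_num

theorem toU_qbracket (a b : RootLattice) (x y : CFree) : toU (qbracket a b x y) =
    toU x * toU y - ((-1 : ℂ⟦X⟧) ^ (par a * par b).val * qc (bracketExp a b : ℂ)) •
      (toU y * toU x) := by
  rw [qbracket, map_sub, map_smul, map_mul, map_mul]

namespace U

theorem K_mul_K (i j : Fin 3) : K i * K j = K j * K i := by
  have h := toU_relator (Relator.KK i j)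
  rw [toU_qbracket] at h
  simpa [par, bracketExp, bil, qc_zero, K, sub_eq_zero] using h

theorem K_mul_E (i : Fin 3) (j : Fin 2) :
    K i * E j = E j * K i + (PowerSeries.C (rootVal j i) : ℂ⟦X⟧) • E j := by
  have h := toU_relator (Relator.KE i j)
  rw [map_sub, toU_qbracket, map_smul] at h
  simpa [par, bracketExp, bil, qc_zero, K, E, F, sub_eq_zero, sub_eq_iff_eq_add'] using h

theorem K_mul_F (i : Fin 3) (j : Fin 2) :
    K i * F j = F j * K i + (PowerSeries.C (-rootVal j i) : ℂ⟦X⟧) • F j := by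
  have h := toU_relator (Relator.KF i j)
  rw [map_add, toU_qbracket, map_smul] at h
  rw [map_neg, neg_smul, ← sub_eq_add_neg, eq_sub_iff_add_eq, ← sub_eq_zero]
  simpa [par, bracketExp, bil, qc_zero, K, F, sub_add_eq_add_sub] using h

theorem qK_mul_qK (a b c a' b' c' : ℤ) :
    qK a b c * qK a' b' c' = qK (a + a') (b + b') (c + c') := by
  have hK (i j : Fin 3) : Commute (constU (FreeAlgebra.ι ℂ (Gen.K i)))
      (constU (FreeAlgebra.ι ℂ (Gen.K j))) := K_mul_K i j
  rw [qK, qK, toU_qpow_mul_qpow, qK]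
  · congr 2
    module
  · simp only [map_add, map_zsmul]
    refine .add_left (.add_left ?_ ?_) ?_ <;> refine .add_right (.add_right ?_ ?_) ?_ <;>
      exact Commute.smul_right (Commute.smul_left (hK _ _) _) _

/-- Moving the exponent past `e` shifts it by a scalar, and the exponential turns this shift into a
power of `q`. -/
theorem qK_mul_constU {e : FreeGen} {s : Fin 3 → ℂ}
    (h : ∀ i, K i * constU e = constU e * K i + (PowerSeries.C (s i) : ℂ⟦X⟧) • constU e)
    (a b c : ℤ) :
    qK a b c * constU e = qc (a * s 0 + b * s 1 + c * s 2) • (constU e * qK a b c) := by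
  have h' (i : Fin 3) : constU (FreeAlgebra.ι ℂ (Gen.K i)) * constU e =
    constU e * constU (FreeAlgebra.ι ℂ (Gen.K i)) + (PowerSeries.C (s i) : ℂ⟦X⟧) • constU e := h i
  rw [qK, ← mul_smul_comm, ← toU_qpow_add_algebraMap]
  apply toU_qpow_semiconj
  rw [SemiconjBy, map_add constU, constU_algebraMap, mul_add, ← Algebra.commutes,
    ← Algebra.smul_def]
  simp only [map_add, map_zsmul, map_mul, map_intCast, mul_add, add_mul, smul_mul_assoc,
    mul_smul_comm, h', smul_add]
  simp only [← Int.cast_smul_eq_zsmul ℂ⟦X⟧]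
  simp only [add_smul, mul_smul]
  abel

theorem qK_mul_E (j : Fin 2) (a b c : ℤ) : qK a b c * E j =
    qc (a * rootVal j 0 + b * rootVal j 1 + c * rootVal j 2) • (E j * qK a b c) :=
  qK_mul_constU (e := FreeAlgebra.ι ℂ (Gen.E j)) (fun i => K_mul_E i j) a b c

theorem F_mul_qK (j : Fin 2) (a b c : ℤ) : F j * qK a b c =
    qc (a * rootVal j 0 + b * rootVal j 1 + c * rootVal j 2) • (qK a b c * F j) := by
  have h : qK a b c * F j = _ :=
    qK_mul_constU (e := FreeAlgebra.ι ℂ (Gen.F j)) (fun i => K_mul_F i j) a b c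
  rw [h, smul_smul, ← qc_add]
  ring_nf
  rw [qc_zero, one_smul]
  rfl

theorem toU_qnum_cartanH (i : Fin 2) : kappa • toU (CFree.qnum (cartanH i)) =
    toU (CFree.qpow (cartanH i)) - toU (CFree.qpow (-cartanH i)) := by
  rw [← map_smul, CFree.kappa_smul_qnum, map_sub]

theorem E_mul_F (i j : Fin 2) : E i * F j =
    (-1 : ℂ⟦X⟧) ^ (par (simpleRoot i) * par (simpleRoot j)).val • (F j * E i) +
      if i = j then toU (CFree.qnum (cartanH i)) else 0 := by
  have h := toU_relator (Relator.EF i j)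
  rw [map_sub, toU_qbracket, sub_eq_zero, sub_eq_iff_eq_add'] at h
  have h2 : bracketExp (simpleRoot i) (-simpleRoot j) = 0 := by
    fin_cases i <;> fin_cases j <;> simp [bracketExp, simpleRoot]
  have h3 : par (-simpleRoot j) = par (simpleRoot j) := by
    fin_cases j <;> simp [par, simpleRoot]
  rw [h2, h3, Int.cast_zero, qc_zero, mul_one] at h
  rw [← map_zero toU, ← apply_ite]
  exact h

theorem eq_zero_of_add_self_eq_zero {u : U} (h : u + u = 0) : u = 0 := by
  have h2 : (2 : ℂ⟦X⟧) • u = 0 := by rw [two_smul, h]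
  have hu : IsUnit (2 : ℂ⟦X⟧) := by
    rw [PowerSeries.isUnit_iff_constantCoeff, map_ofNat]
    exact isUnit_iff_ne_zero.2 two_ne_zero
  exact hu.smul_eq_zero.1 h2

theorem E_one_mul_E_one : E 1 * E 1 = 0 := by
  have h := toU_relator Relator.EE
  rw [toU_qbracket] at h
  have h2 : (-1 : ℂ⟦X⟧) ^ (1 : ZMod 2).val = -1 := by simp [ZMod.val_one]
  have h3 : E 1 * E 1 + E 1 * E 1 = 0 := by
    simpa [par, bracketExp, bil, simpleRoot, qc_zero, h2, E, F] using h
  exact eq_zero_of_add_self_eq_zero h3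

theorem F_one_mul_F_one : F 1 * F 1 = 0 := by
  have h := toU_relator Relator.FF
  rw [toU_qbracket] at h
  have h2 : (-1 : ℂ⟦X⟧) ^ (1 : ZMod 2).val = -1 := by simp [ZMod.val_one]
  have h3 : F 1 * F 1 + F 1 * F 1 = 0 := by
    simpa [par, bracketExp, bil, simpleRoot, qc_zero, h2, E, F] using h
  exact eq_zero_of_add_self_eq_zero h3

theorem kappa_smul_qnum_cartanH_zero :
    kappa • toU (CFree.qnum (cartanH 0)) = qK 1 (-1) 0 - qK (-1) 1 0 := by
  rw [toU_qnum_cartanH, qK, qK]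
  congr 3 <;> simp [cartanH] <;> abel

theorem kappa_smul_qnum_cartanH_one :
    kappa • toU (CFree.qnum (cartanH 1)) = qK 0 1 1 - qK 0 (-1) (-1) := by
  rw [toU_qnum_cartanH, qK, qK]
  congr 3 <;> simp [cartanH]
  abel

theorem E_zero_serre : E 0 * rootE (fun n : ℤ => qc n) (E 0) (E 1) =
    qc 1 • (rootE (fun n : ℤ => qc n) (E 0) (E 1) * E 0) := by
  have h := toU_relator Relator.serreE
  rw [toU_qbracket, toU_qbracket] at h
  have h2 : E 0 * (E 0 * E 1 - qc 1 • (E 1 * E 0)) -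
      qc (-1) • ((E 0 * E 1 - qc 1 • (E 1 * E 0)) * E 0) = 0 := by
    simpa [par, simpleRoot, bracketExp, bil, E, F] using h
  simpa [rootE] using serre_left h2

theorem F_zero_serre : rootF (fun n : ℤ => qc n) (F 0) (F 1) * F 0 =
    qc 1 • (F 0 * rootF (fun n : ℤ => qc n) (F 0) (F 1)) := by
  have h := toU_relator Relator.serreF
  rw [toU_qbracket, toU_qbracket] at h
  have h2 : F 0 * (F 0 * F 1 - qc (-1) • (F 1 * F 0)) -
      qc 1 • ((F 0 * F 1 - qc (-1) • (F 1 * F 0)) * F 0) = 0 := by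
    simpa [par, simpleRoot, bracketExp, bil, E, F] using h
  simpa [rootF] using serre_right (qc_mul_qc_neg 1) h2

theorem relations : Relations (fun n : ℤ => qc n) qK (E 0) (E 1) (F 0) (F 1) where
  t_zero := by rw [Int.cast_zero, qc_zero]
  t_add m n := by rw [Int.cast_add, qc_add]
  isUnit_two := by simpa [qTwo] using isUnit_qTwo
  L_mul_L := qK_mul_qK
  L_mul_E₁ a b c := by simpa [rootVal, sub_eq_add_neg] using qK_mul_E 0 a b c
  L_mul_E₂ a b c := by simpa [rootVal, sub_eq_add_neg] using qK_mul_E 1 a b c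
  F₁_mul_L a b c := by simpa [rootVal, sub_eq_add_neg] using F_mul_qK 0 a b c
  F₂_mul_L a b c := by simpa [rootVal, sub_eq_add_neg] using F_mul_qK 1 a b c
  E₁_F₁ := by
    rw [← kappa_smul_qnum_cartanH_zero, E_mul_F 0 0]
    simp [par, simpleRoot, kappa]
  E₂_F₂ := by
    rw [← kappa_smul_qnum_cartanH_one, E_mul_F 1 1]
    simp [par, simpleRoot, kappa, ZMod.val_one]
  E₁_F₂ := by simpa [par, simpleRoot] using E_mul_F 0 1
  E₂_F₁ := by simpa [par, simpleRoot] using E_mul_F 1 0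
  E₂_mul_E₂ := E_one_mul_E_one
  F₂_mul_F₂ := F_one_mul_F_one
  serreE := by rw [Int.cast_one]; exact E_zero_serre
  serreF := by rw [Int.cast_one]; exact F_zero_serre

theorem Phi1_eq : Phi1 = phi1 (fun n : ℤ => qc n) qK (E 0) (E 1)
    (rootE (fun n : ℤ => qc n) (E 0) (E 1)) (F 0) (F 1)
    (rootF (fun n : ℤ => qc n) (F 0) (F 1)) := by
  simp only [Phi1, phi1, rootE, rootF, F13, Ebar13, E12, E23, F12, F23, kappa, Int.cast_neg,
    Int.cast_one, Int.cast_ofNat]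

theorem Phi2_eq : Phi2 = phi2 (fun n : ℤ => qc n) qK (E 0) (E 1)
    (rootE (fun n : ℤ => qc n) (E 0) (E 1)) (F 0) (F 1)
    (rootF (fun n : ℤ => qc n) (F 0) (F 1)) := by
  simp only [Phi2, phi2, rootE, rootF, F13, Ebar13, E12, E23, F12, F23, kappa, qTwo, Int.cast_neg,
    Int.cast_one, Int.cast_ofNat]

/-! ### Weights and centrality in `U` -/

/-- The elements of a given weight for the adjoint action of `K₁, K₂, K₃`. -/
def weightSpace (w : RootLattice) : Submodule ℂ⟦X⟧ U where
  carrier := {x | ∀ i, K i * x =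
    x * K i + (PowerSeries.C (w.1 * rootVal 0 i + w.2 * rootVal 1 i) : ℂ⟦X⟧) • x}
  zero_mem' i := by simp
  add_mem' hx hy i := by rw [mul_add, hx i, hy i, add_mul, smul_add, add_add_add_comm]
  smul_mem' c x hx i := by
    rw [mul_smul_comm, hx i, smul_add, smul_mul_assoc, smul_comm c]

theorem mul_mem_weightSpace (a b : RootLattice) (x y : U) (hx : x ∈ weightSpace a)
    (hy : y ∈ weightSpace b) : x * y ∈ weightSpace (a + b) := by
  intro i
  rw [← mul_assoc, hx i, add_mul, mul_assoc, hy i, mul_add, smul_mul_assoc, mul_smul_comm,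
    ← mul_assoc, add_assoc, ← add_smul, ← map_add]
  congr 3
  rw [Prod.fst_add, Prod.snd_add]
  push_cast
  ring

theorem commute_K_qK (i : Fin 3) (a b c : ℤ) : Commute (K i) (qK a b c) := by
  have hK (j : Fin 3) : Commute (constU (FreeAlgebra.ι ℂ (Gen.K j)))
      (constU (FreeAlgebra.ι ℂ (Gen.K i))) := K_mul_K j i
  refine Commute.symm (toU_qpow_semiconj (e := FreeAlgebra.ι ℂ (Gen.K i))
    (a := a • FreeAlgebra.ι ℂ (Gen.K 0) + b • FreeAlgebra.ι ℂ (Gen.K 1) +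
      c • FreeAlgebra.ι ℂ (Gen.K 2)) ?_)
  simp only [map_add, map_zsmul]
  exact .add_right (.add_right (Commute.smul_right (hK _).symm _)
    (Commute.smul_right (hK _).symm _)) (Commute.smul_right (hK _).symm _)

theorem Phi_mem_weightSpace : Phi1 ∈ weightSpace 0 ∧ Phi2 ∈ weightSpace 0 := by
  rw [Phi1_eq, Phi2_eq]
  refine phi_mem_of_graded weightSpace mul_mem_weightSpace _ (a := simpleRoot 0)
    (b := simpleRoot 1) (fun a b c => ?_) ?_ ?_ ?_ ?_
  · intro i
    simpa using (commute_K_qK i a b c).eq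
  · intro i; rw [K_mul_E]; simp [simpleRoot]
  · intro i; rw [K_mul_E]; simp [simpleRoot]
  · intro i; rw [K_mul_F]; simp [simpleRoot]
  · intro i; rw [K_mul_F]; simp [simpleRoot]

theorem Phi_mem_center :
    Phi1 ∈ Subalgebra.center ℂ⟦X⟧ U ∧ Phi2 ∈ Subalgebra.center ℂ⟦X⟧ U := by
  have hK := Phi_mem_weightSpace
  have hE := relations.commute_E
  have hF := relations.commute_F
  rw [← Phi1_eq, ← Phi2_eq] at hE hF
  constructor <;> refine mem_center_of_commute_gen _ fun g => ?_
  · match g with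
    | .K i => exact Commute.symm (show K i * Phi1 = Phi1 * K i by simpa using hK.1 i)
    | .E 0 => exact hE.1.1.symm
    | .E 1 => exact hE.1.2.symm
    | .F 0 => exact hF.1.1.symm
    | .F 1 => exact hF.1.2.symm
  · match g with
    | .K i => exact Commute.symm (show K i * Phi2 = Phi2 * K i by simpa using hK.2 i)
    | .E 0 => exact hE.2.1.symm
    | .E 1 => exact hE.2.2.symm
    | .F 0 => exact hF.2.1.symm
    | .F 1 => exact hF.2.2.symm

end U

/-! ### Parity -/

theorem CFree.coeff_mul (n : ℕ) (x y : CFree) : (x * y).coeff n =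
    ∑ p ∈ Finset.HasAntidiagonal.antidiagonal n, x.coeff p.1 * y.coeff p.2 :=
  PowerSeries.coeff_mul n _ _

theorem CFree.coeff_add (n : ℕ) (x y : CFree) : (x + y).coeff n = x.coeff n + y.coeff n := rfl

theorem CFree.coeff_zero' (n : ℕ) : (0 : CFree).coeff n = 0 := rfl

theorem CFree.coeff_algebraMap (n : ℕ) (c : ℂ⟦X⟧) : (algebraMap ℂ⟦X⟧ CFree c).coeff n =
    algebraMap ℂ FreeGen (PowerSeries.coeff n c) :=
  PowerSeries.coeff_map (algebraMap ℂ FreeGen) n c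

theorem CFree.coeff_smul (n : ℕ) (c : ℂ⟦X⟧) (x : CFree) : (c • x).coeff n =
    ∑ p ∈ Finset.HasAntidiagonal.antidiagonal n, PowerSeries.coeff p.1 c • x.coeff p.2 := by
  rw [Algebra.smul_def, CFree.coeff_mul]
  simp only [CFree.coeff_algebraMap, ← Algebra.smul_def]

theorem CFree.coeff_qpow (n : ℕ) (a : FreeGen) :
    (CFree.qpow a).coeff n = ((n.factorial : ℂ)⁻¹) • a ^ n := coeff_qExp a n

theorem CFree.coeff_gen (n : ℕ) (g : Gen) :
    (CFree.gen g).coeff n = if n = 0 then FreeAlgebra.ι ℂ g else 0 := PowerSeries.coeff_C n _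

theorem neg_one_pow_val_add (a b : ZMod 2) :
    (-1 : ℂ) ^ (a + b).val = (-1) ^ a.val * (-1) ^ b.val := by
  rw [← pow_add, ZMod.val_add]
  exact neg_one_pow_congr (by rw [Nat.even_iff, Nat.even_iff, Nat.mod_mod])

/-- The homogeneous elements of parity `p`. -/
def paritySpace (p : ZMod 2) : Submodule ℂ⟦X⟧ U where
  carrier := {u | HasParity p u}
  zero_mem' := ⟨0, fun n => by rw [CFree.coeff_zero', map_zero, smul_zero], map_zero _⟩
  add_mem' := by
    rintro _ _ ⟨x, hx, rfl⟩ ⟨y, hy, rfl⟩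
    exact ⟨x + y, fun n => by rw [CFree.coeff_add, map_add, hx, hy, smul_add], map_add _ _ _⟩
  smul_mem' := by
    rintro c _ ⟨x, hx, rfl⟩
    refine ⟨c • x, fun n => ?_, map_smul _ _ _⟩
    rw [CFree.coeff_smul, map_sum, Finset.smul_sum]
    refine Finset.sum_congr rfl fun i _ => ?_
    rw [map_smul, hx, smul_comm]

theorem mul_mem_paritySpace (a b : ZMod 2) (u w : U) (hu : u ∈ paritySpace a)
    (hw : w ∈ paritySpace b) : u * w ∈ paritySpace (a + b) := by
  obtain ⟨x, hx, rfl⟩ := hu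
  obtain ⟨y, hy, rfl⟩ := hw
  refine ⟨x * y, fun n => ?_, map_mul _ _ _⟩
  rw [CFree.coeff_mul, map_sum, Finset.smul_sum]
  refine Finset.sum_congr rfl fun i _ => ?_
  rw [map_mul, hx, hy, smul_mul_smul_comm, neg_one_pow_val_add]

theorem toU_gen_mem_paritySpace {p : ZMod 2} {g : Gen} (h : parityAut (FreeAlgebra.ι ℂ g) =
    (-1 : ℂ) ^ p.val • FreeAlgebra.ι ℂ g) : toU (CFree.gen g) ∈ paritySpace p := by
  refine ⟨_, fun n => ?_, rfl⟩
  rw [CFree.coeff_gen]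
  split_ifs
  · exact h
  · rw [map_zero, smul_zero]

theorem parityAut_K (i : Fin 3) :
    parityAut (FreeAlgebra.ι ℂ (.K i)) = FreeAlgebra.ι ℂ (.K i) := by
  rw [parityAut, FreeAlgebra.lift_ι_apply]

theorem qK_mem_paritySpace (a b c : ℤ) : U.qK a b c ∈ paritySpace 0 := by
  refine ⟨_, fun n => ?_, rfl⟩
  rw [CFree.coeff_qpow, map_smul, map_pow]
  simp only [map_add, map_zsmul, parityAut_K, ZMod.val_zero, pow_zero, one_smul]

theorem hasParity_Phi : HasParity 0 U.Phi1 ∧ HasParity 0 U.Phi2 := by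
  have h : U.Phi1 ∈ paritySpace 0 ∧ U.Phi2 ∈ paritySpace 0 := by
    rw [U.Phi1_eq, U.Phi2_eq]
    refine phi_mem_of_graded paritySpace mul_mem_paritySpace _ (a := par (simpleRoot 0))
      (b := par (simpleRoot 1)) qK_mem_paritySpace ?_ ?_ ?_ ?_
    · exact toU_gen_mem_paritySpace (by rw [parityAut, FreeAlgebra.lift_ι_apply])
    · exact toU_gen_mem_paritySpace (by rw [parityAut, FreeAlgebra.lift_ι_apply])
    -- Opposite degrees coincide in `ZMod 2`, so `F_i` has the parity of `E_i`.
    · rw [ZMod.neg_eq_self_mod_two]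
      exact toU_gen_mem_paritySpace (by rw [parityAut, FreeAlgebra.lift_ι_apply])
    · rw [ZMod.neg_eq_self_mod_two]
      exact toU_gen_mem_paritySpace (by rw [parityAut, FreeAlgebra.lift_ι_apply])
  exact h

/-! ### The action on highest weight modules -/

section HighestWeight

variable {V : Type*} [AddCommGroup V] [Module ℂ⟦X⟧ V] [Module U V] [IsScalarTower ℂ⟦X⟧ U V]
  {l : Fin 3 → ℂ} {v : V}

theorem qK_smul (hK : ∀ i, U.K i • v = (PowerSeries.C (l i) : ℂ⟦X⟧) • v) (a b c : ℤ) :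
    U.qK a b c • v = qc (a * l 0 + b * l 1 + c * l 2) • v := by
  have hK' (i : Fin 3) : constU (FreeAlgebra.ι ℂ (Gen.K i)) • v =
    (PowerSeries.C (l i) : ℂ⟦X⟧) • v := hK i
  apply toU_qpow_smul_of_constU_smul
  simp only [map_add, map_zsmul, add_smul, smul_assoc, hK', map_mul, map_intCast, mul_smul,
    Int.cast_smul_eq_zsmul]

theorem Phi_smul_of_highest_weight (hE : ∀ i, U.E i • v = 0)
    (hK : ∀ i, U.K i • v = (PowerSeries.C (l i) : ℂ⟦X⟧) • v) :
    U.Phi1 • v = chi1 l • v ∧ U.Phi2 • v = chi2 l • v := by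
  have hE3 : U.Ebar13 • v = 0 := by
    rw [U.Ebar13, sub_smul, mul_smul, smul_assoc, mul_smul, hE, hE, smul_zero, smul_zero,
      smul_zero, sub_zero]
  have h1 : U.E12 • v = 0 := hE 0
  have h2 : U.E23 • v = 0 := hE 1
  have : SMulCommClass U ℂ⟦X⟧ V := IsScalarTower.to_smulCommClass'
  constructor
  -- In every non-Cartan term the factor just before the power of `q` is a positive root vector,
  -- which kills `v`.
  · simp only [U.Phi1, chi1, add_smul, sub_smul, smul_assoc, mul_smul, qK_smul hK,
      smul_comm (_ : U) (_ : ℂ⟦X⟧) v, h1, h2, hE3, smul_zero, add_zero]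
    simp only [smul_smul, ← qc_add]
    push_cast
    ring_nf
  · simp only [U.Phi2, chi2, add_smul, sub_smul, smul_assoc, mul_smul, qK_smul hK, pow_two U.E12,
      smul_comm (_ : U) (_ : ℂ⟦X⟧) v, h1, h2, hE3, smul_zero, add_zero]
    simp only [smul_smul, ← qc_add]
    push_cast
    ring_nf

/-- Every vector is `u • v`, and a central element passes through `u` to act on `v`. -/
theorem Phi_smul_of_span_eq_top (hE : ∀ i, U.E i • v = 0)
    (hK : ∀ i, U.K i • v = (PowerSeries.C (l i) : ℂ⟦X⟧) • v) (hv : Submodule.span U {v} = ⊤)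
    (x : V) : U.Phi1 • x = chi1 l • x ∧ U.Phi2 • x = chi2 l • x := by
  have : SMulCommClass U ℂ⟦X⟧ V := IsScalarTower.to_smulCommClass'
  obtain ⟨u, rfl⟩ := Submodule.mem_span_singleton.1 (hv ▸ Submodule.mem_top : x ∈ _)
  have hc := U.Phi_mem_center
  rw [Subalgebra.mem_center_iff, Subalgebra.mem_center_iff] at hc
  have h := Phi_smul_of_highest_weight hE hK
  rw [smul_smul, ← hc.1, mul_smul, h.1, smul_smul, ← hc.2, mul_smul, h.2, smul_comm, smul_comm u]
  exact ⟨rfl, rfl⟩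

end HighestWeight

end QuantumGl21

end

open QuantumGl21 in
theorem mainTheorem3 :
    (U.Phi1 ∈ Subalgebra.center ℂ⟦X⟧ U ∧ U.Phi2 ∈ Subalgebra.center ℂ⟦X⟧ U) ∧
    (HasParity 0 U.Phi1 ∧ HasParity 0 U.Phi2) ∧
    (∀ (l : Fin 3 → ℂ) (x : IrrModule l),
      U.Phi1 • x = chi1 l • x ∧ U.Phi2 • x = chi2 l • x) ∧
    (∀ (V : Type*) [AddCommGroup V] [Module ℂ⟦X⟧ V] [Module U V] [IsScalarTower ℂ⟦X⟧ U V]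
      (l : Fin 3 → ℂ) (v : V), IsHighestWeight V l v →
      ∀ x : V, U.Phi1 • x = chi1 l • x ∧ U.Phi2 • x = chi2 l • x) := by
  refine ⟨U.Phi_mem_center, hasParity_Phi, fun l x => ?_, fun V _ _ _ _ l v hv =>
    Phi_smul_of_span_eq_top hv.E_smul hv.K_smul hv.span_eq_top⟩
  -- The class of `1` generates the double quotient and is annihilated by `vermaIdeal l`; this
  -- already yields its highest weight equations.
  have hm {u : U} (hu : u ∈ vermaIdeal l) :
      u • (Submodule.Quotient.mk (vermaVec l) : IrrModule l) = 0 := by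
    rw [vermaVec, ← Submodule.Quotient.mk_smul, ← Submodule.Quotient.mk_smul, smul_eq_mul,
      mul_one, (Submodule.Quotient.mk_eq_zero _).2 hu, Submodule.Quotient.mk_zero]
  refine Phi_smul_of_span_eq_top (v := (Submodule.Quotient.mk (vermaVec l) : IrrModule l))
    (fun i => hm (Submodule.subset_span (.inl ⟨i, rfl⟩))) (fun i => ?_) ?_ x
  · have h := hm (Submodule.subset_span (.inr ⟨i, rfl⟩))
    rwa [sub_smul, algebraMap_smul, sub_eq_zero] at h
  · rw [eq_top_iff]
    rintro y -
    obtain ⟨y, rfl⟩ := Submodule.Quotient.mk_surjective _ y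
    obtain ⟨u, rfl⟩ := Submodule.Quotient.mk_surjective _ y
    refine Submodule.mem_span_singleton.2 ⟨u, ?_⟩
    rw [vermaVec, ← Submodule.Quotient.mk_smul, ← Submodule.Quotient.mk_smul, smul_eq_mul, mul_one]
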